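/- All graphs are finite and simple. An *obstacle* is a topologically open non-self-intersecting polygon $C$ in the plane (the bounded region enclosed by a simple closed polygonal curve). A *(single-)obstacle representation* of a graph $G$ consists of an obstacle $C$ and a placement of the vertices of $G$ at distinct points in general position (no three on a line) in the complement of $C$, such that two distinct vertices at points $p,q$ are adjacent in $G$ if and only if $\overline{pq}\cap C=\emptyset$. The *drawing* of $G$ is the union of these points and of the straight-line segments representing the edges. The representation is an *outside-obstacle representation* if $C$ is contained in the unbounded component of the complement of the drawing, and an *inside-obstacle representation* if $C$ is disjoint from that unbounded component. Theorem. The class of graphs with an inside-obstacle representation and the class of graphs with an outside-obstacle representation are incomparable, i.e. neither contains the other. More precisely: 1. Let $B_{11}$ be the graph on the 11 vertices $z_1,\dots,z_5,z_1',\dots,z_5',v$ obtained from the complete graph on $z_1,\dots,z_5,z_1',\dots,z_5'$ by deleting the five edges $z_iz_i'$ and adding a vertex $v$ adjacent to exactly $z_1,\dots,z_5$. Then $B_{11}$ has an inside-obstacle representation but no outside-obstacle representation. 2. Every acyclic non-complete graph has an outside-obstacle representation but no inside-obstacle representation. 3. The complete bipartite graph $K_{2,3}$ has an outside-obstacle representation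 but no inside-obstacle representation. -/

import Mathlib

/-- The Euclidean plane. -/
abbrev Plane : Type := EuclideanSpace ℝ (Fin 2)

/-- A closed polygon (in the plane) is simple, i.e. non-self-intersecting: it has at least three
vertices, no edge degenerates to a point, consecutive edges meet only in their common vertex, and
non-consecutive edges are disjoint. -/
def PolygonIsSimple {n : ℕ} (poly : Polygon Plane n) : Prop :=
  3 ≤ n ∧ poly.HasNondegenerateEdges ∧
  (∀ i : Fin n,
    poly.edgeSet ℝ i ∩ poly.edgeSet ℝ (finRotate n i) = {poly (finRotate n i)}) ∧
  (∀ i j : Fin n, i ≠ j → j ≠ finRotate n i → i ≠ finRotate n j →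
    Disjoint (poly.edgeSet ℝ i) (poly.edgeSet ℝ j))

/-- `C` is a (topologically open) non-self-intersecting polygon: the region enclosed by a simple
closed polygon. A nonempty bounded connected open set whose topological boundary is a simple closed
polygonal curve `J` is precisely the bounded connected component of the complement of `J`. -/
def IsOpenSimplePolygon (C : Set Plane) : Prop :=
  IsOpen C ∧ IsConnected C ∧ Bornology.IsBounded C ∧
  ∃ (n : ℕ) (poly : Polygon Plane n), PolygonIsSimple poly ∧ frontier C = poly.boundary ℝ

/-- The vertices are placed at distinct points, no three of which lie on a line. -/
def InGeneralPosition {V : Type*} (p : V → Plane) : Prop :=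
  Function.Injective p ∧
  ∀ u v w : V, u ≠ v → u ≠ w → v ≠ w → ¬ Collinear ℝ {p u, p v, p w}

/-- `G` is the visibility graph of the points `p` (in general position, and in the complement of
the obstacle) with respect to the single obstacle `C`: two distinct vertices are adjacent exactly
when the closed segment between their points misses `C`. -/
def IsObstacleRepresentation {V : Type*} (G : SimpleGraph V) (p : V → Plane) (C : Set Plane) :
    Prop :=
  IsOpenSimplePolygon C ∧ InGeneralPosition p ∧ (∀ v, p v ∉ C) ∧
  ∀ u v : V, G.Adj u v ↔ u ≠ v ∧ Disjoint (segment ℝ (p u) (p v)) C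

/-- The point set of the straight-line drawing of `G` with vertex placement `p`. -/
def straightLineDrawing {V : Type*} (G : SimpleGraph V) (p : V → Plane) : Set Plane :=
  Set.range p ∪ {x | ∃ u v : V, G.Adj u v ∧ x ∈ segment ℝ (p u) (p v)}

/-- The unbounded component of the complement of a (bounded) set `D` in the plane. -/
def unboundedComponent (D : Set Plane) : Set Plane :=
  {x | x ∈ Dᶜ ∧ ¬ Bornology.IsBounded (connectedComponentIn Dᶜ x)}

/-- `G` can be represented by a single outside obstacle, i.e. by an obstacle that lies in the
unbounded component of the visibility drawing. -/
def HasOutsideObstacleRepresentation {V : Type*} (G : SimpleGraph V) : Prop :=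
  ∃ (p : V → Plane) (C : Set Plane), IsObstacleRepresentation G p C ∧
    C ⊆ unboundedComponent (straightLineDrawing G p)

/-- `G` can be represented by a single inside obstacle, i.e. by an obstacle that lies in the
complement of the unbounded component of the visibility drawing. -/
def HasInsideObstacleRepresentation {V : Type*} (G : SimpleGraph V) : Prop :=
  ∃ (p : V → Plane) (C : Set Plane), IsObstacleRepresentation G p C ∧
    C ⊆ (unboundedComponent (straightLineDrawing G p))ᶜ

/-- The class of finite simple graphs (each given on a vertex set `Fin n`) that have an
inside-obstacle representation. -/
def insideObstacleClass : Set (Σ n : ℕ, SimpleGraph (Fin n)) :=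
  {G | HasInsideObstacleRepresentation G.2}

/-- The class of finite simple graphs (each given on a vertex set `Fin n`) that have an
outside-obstacle representation. -/
def outsideObstacleClass : Set (Σ n : ℕ, SimpleGraph (Fin n)) :=
  {G | HasOutsideObstacleRepresentation G.2}

/-- The vertices `z i`, `z' i` (for `i : Fin 5`) and `v` of the graph `B₁₁`. -/
inductive B11Vertex : Type
  | z (i : Fin 5)
  | z' (i : Fin 5)
  | v
  deriving DecidableEq

/-- The non-edges (between distinct vertices) of `B₁₁`, in one of the two orders:
the matching pairs `z i, z' i`, and all pairs `v, z' i`. -/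
def B11NonEdge : B11Vertex → B11Vertex → Prop
  | .z i, .z' j => i = j
  | .v, .z' _ => True
  | _, _ => False

/-- The 11-vertex graph `B₁₁`: the complete graph on `z 0, …, z 4, z' 0, …, z' 4` without the
perfect matching `{z i z' i}`, plus a vertex `v` adjacent to exactly `z 0, …, z 4`. -/
def B11 : SimpleGraph B11Vertex where
  Adj x y := x ≠ y ∧ ¬ B11NonEdge x y ∧ ¬ B11NonEdge y x
  symm := ⟨fun _ _ h => ⟨h.1.symm, h.2.2, h.2.1⟩⟩
  loopless := ⟨fun _ h => h.1 rfl⟩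

/-! Everything is reduced to signs of `cross`, the orientation of a triple of points.

No outside obstacle for `B11`: if `b`, `d` are non-adjacent and have common neighbours on both sides
of the line `bd`, the four edges enclose the segment `bd`, so no outside obstacle can block it.
Hence all common neighbours lie on one side (`common_neighbors_same_side`). In `B11` this puts all
other `z j`, `z' j` on one side of each line through `z i`, `z' i`, and all `z j` with `j ≠ i` on
one side of the line through `v`, `z' i`. By pigeonhole three of the latter lines have the same
orientation, and then the Grassmann–Plücker relations are violated (`no_three_blocks`).

Outside obstacles: a comb is hung over the drawing. Its lower boundary is the graph of a piecewise
affine function that stays above all edges and dips where a missing edge runs above all edges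
(`hasOutsideObstacleRepresentation_of_exposed`). A forest gets a suitable placement by adding
leaves: a new vertex sits very close to its neighbour, up a very steep slope. For `K_{2,3}`
coordinates are given.

No inside obstacle: the obstacle lies in a bounded face of the drawing. If the graph is
triangle-free, all corners of the convex hull of that face are vertices
(`hullCorners_subset_range`), and consecutive corners are adjacent because the obstacle lies
strictly on one side of each hull side (`exists_convex_cycle_of_inside`). A forest has no such
cycle. In `K_{2,3}` it is a quadrilateral with the fifth vertex inside; two edges at that vertex cut
the quadrilateral in two, yet the connected obstacle would have to meet both parts.

`B11` has an inside obstacle by explicit coordinates: a triangle around the centre of a decagon.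
Incomparability is witnessed by `B11` and by the edgeless graph on two vertices. -/

open Set Topology Filter

/-! ### Orientations, half-planes and triangles -/

/-- Twice the signed area of the triangle `a b c`. -/
def cross (a b c : Plane) : ℝ :=
  (b 0 - a 0) * (c 1 - a 1) - (b 1 - a 1) * (c 0 - a 0)

theorem Plane.ext' {a b : Plane} (h0 : a 0 = b 0) (h1 : a 1 = b 1) : a = b := by
  ext i; fin_cases i <;> assumption

theorem continuous_cross (a b : Plane) : Continuous (cross a b) := by
  unfold cross; fun_prop

theorem cross_rotate (a b c : Plane) : cross b c a = cross a b c := by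
  unfold cross; ring

theorem cross_swap (a b c : Plane) : cross b a c = -cross a b c := by
  unfold cross; ring

theorem cross_swap' (a b c : Plane) : cross a c b = -cross a b c := by
  unfold cross; ring

theorem cross_self_left (a b : Plane) : cross a b a = 0 := by unfold cross; ring

theorem cross_self_right (a b : Plane) : cross a b b = 0 := by unfold cross; ring

theorem cross_combo (a b x y : Plane) {s t : ℝ} (h : s + t = 1) :
    cross a b (s • x + t • y) = s * cross a b x + t * cross a b y := by
  obtain rfl : s = 1 - t := by linarith
  simp only [cross, PiLp.add_apply, PiLp.smul_apply, smul_eq_mul]; ring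

theorem cross_add_smul_sub (a b x y z : Plane) (t : ℝ) :
    cross a b (x + t • (y - z)) = cross a b x + t * (cross a b y - cross a b z) := by
  simp only [cross, PiLp.add_apply, PiLp.sub_apply, PiLp.smul_apply, smul_eq_mul]; ring

/-- The three-term Grassmann–Plücker relation. -/
theorem cross_pluecker (a b c d e : Plane) :
    cross a b c * cross a d e - cross a b d * cross a c e + cross a b e * cross a c d = 0 := by
  unfold cross; ring

/-- Barycentric coordinates with denominators cleared, so that it also holds for degenerate
triangles. -/
theorem cross_smul (a b c x : Plane) :
    cross a b c • x = cross b c x • a + cross c a x • b + cross a b x • c := by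
  apply Plane.ext' <;>
    simp only [cross, PiLp.add_apply, PiLp.smul_apply, smul_eq_mul] <;> ring

theorem collinear_iff_cross (a b c : Plane) : Collinear ℝ {a, b, c} ↔ cross a b c = 0 := by
  rw [collinear_iff_of_mem (p₀ := a) (by simp)]
  constructor
  · rintro ⟨v, hv⟩
    obtain ⟨r, hr⟩ := hv b (by simp)
    obtain ⟨s, hs⟩ := hv c (by simp)
    subst hr hs
    simp only [cross, vadd_eq_add, PiLp.add_apply, PiLp.smul_apply, smul_eq_mul]; ring
  · intro h
    by_cases hab : a = b
    · refine ⟨c - a, ?_⟩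
      rintro x (rfl | rfl | rfl)
      · exact ⟨0, by simp⟩
      · exact ⟨0, by simp [hab]⟩
      · exact ⟨1, by simp⟩
    · refine ⟨b - a, ?_⟩
      rintro x (rfl | rfl | rfl)
      · exact ⟨0, by simp⟩
      · exact ⟨1, by simp⟩
      · unfold cross at h
        by_cases h0 : b 0 = a 0
        · have h1 : b 1 - a 1 ≠ 0 := fun h1 => hab (Plane.ext' h0.symm (by linarith))
          refine ⟨(x 1 - a 1) / (b 1 - a 1), Plane.ext' ?_ ?_⟩ <;>
            simp only [vadd_eq_add, PiLp.add_apply, PiLp.sub_apply, PiLp.smul_apply,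
              smul_eq_mul] <;> field_simp <;> nlinarith
        · have h1 : b 0 - a 0 ≠ 0 := sub_ne_zero.2 h0
          refine ⟨(x 0 - a 0) / (b 0 - a 0), Plane.ext' ?_ ?_⟩ <;>
            simp only [vadd_eq_add, PiLp.add_apply, PiLp.sub_apply, PiLp.smul_apply,
              smul_eq_mul] <;> field_simp <;> nlinarith

theorem inGeneralPosition_iff {V : Type*} {p : V → Plane} :
    InGeneralPosition p ↔ Function.Injective p ∧
      ∀ u v w : V, u ≠ v → u ≠ w → v ≠ w → cross (p u) (p v) (p w) ≠ 0 := by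
  simp only [InGeneralPosition, collinear_iff_cross, Ne]

theorem segment_subset_cross_nonneg {a b x y : Plane} (hx : 0 ≤ cross a b x)
    (hy : 0 ≤ cross a b y) {z : Plane} (hz : z ∈ segment ℝ x y) : 0 ≤ cross a b z := by
  obtain ⟨s, t, hs, ht, hst, rfl⟩ := hz
  rw [cross_combo _ _ _ _ hst]; positivity

theorem segment_subset_cross_nonpos {a b x y : Plane} (hx : cross a b x ≤ 0)
    (hy : cross a b y ≤ 0) {z : Plane} (hz : z ∈ segment ℝ x y) : cross a b z ≤ 0 := by
  rw [← neg_nonneg, ← cross_swap] at *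
  exact segment_subset_cross_nonneg hx hy hz

/-- Half-planes are convex. This is the source of all edges that are forced to exist by the position
of the obstacle. -/
theorem disjoint_segment_of_cross_nonpos {a b x y : Plane} {C : Set Plane}
    (hC : ∀ z ∈ C, 0 < cross a b z) (hx : cross a b x ≤ 0) (hy : cross a b y ≤ 0) :
    Disjoint (segment ℝ x y) C :=
  Set.disjoint_left.2 fun _ hz hzC =>
    (hC _ hzC).not_ge (segment_subset_cross_nonpos hx hy hz)

/-- A point of the closed triangle `a b c` that lies on the line `a b` is in the segment `a b`. -/
theorem mem_segment_of_cross {a b c x : Plane} (h : 0 < cross a b c) (h1 : 0 ≤ cross b c x)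
    (h2 : 0 ≤ cross c a x) (h3 : cross a b x = 0) : x ∈ segment ℝ a b := by
  have hx := cross_smul a b c x
  have hsum : cross b c x + cross c a x = cross a b c := by
    have : cross b c x + cross c a x + cross a b x = cross a b c := by unfold cross; ring
    linarith
  refine ⟨cross b c x / cross a b c, cross c a x / cross a b c, by positivity, by positivity,
    by rw [← add_div, hsum, div_self h.ne'], ?_⟩
  rw [h3, zero_smul, add_zero] at hx
  rw [div_eq_inv_mul, div_eq_inv_mul, mul_smul, mul_smul, ← smul_add, ← hx, smul_smul,
    inv_mul_cancel₀ h.ne', one_smul]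

theorem mem_convexHull_of_cross {a b c x : Plane} (h : 0 < cross a b c) (h1 : 0 ≤ cross b c x)
    (h2 : 0 ≤ cross c a x) (h3 : 0 ≤ cross a b x) : x ∈ convexHull ℝ {a, b, c} := by
  have hx := cross_smul a b c x
  have hsum : cross b c x + cross c a x + cross a b x = cross a b c := by unfold cross; ring
  rw [convexHull_insert (by simp), convexHull_pair]
  have : x = (cross b c x / cross a b c) • a + (cross c a x / cross a b c) • b +
      (cross a b x / cross a b c) • c := by
    rw [div_eq_inv_mul, div_eq_inv_mul, div_eq_inv_mul, mul_smul, mul_smul, mul_smul,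
      ← smul_add, ← smul_add, ← hx, smul_smul, inv_mul_cancel₀ h.ne', one_smul]
  have hc : Convex ℝ (convexHull ℝ {a, b, c}) := convex_convexHull ℝ _
  rw [← convexHull_pair, ← convexHull_insert (by simp)]
  have ha : a ∈ convexHull ℝ ({a, b, c} : Set Plane) := subset_convexHull ℝ _ (by simp)
  have hb : b ∈ convexHull ℝ ({a, b, c} : Set Plane) := subset_convexHull ℝ _ (by simp)
  have hcc : c ∈ convexHull ℝ ({a, b, c} : Set Plane) := subset_convexHull ℝ _ (by simp)
  have := hc.sum_mem (t := Finset.univ) (w := ![cross b c x / cross a b c,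
      cross c a x / cross a b c, cross a b x / cross a b c]) (z := ![a, b, c])
      (by intro i _; fin_cases i <;> simp <;> positivity)
      (by simp [Fin.sum_univ_three, ← add_div, hsum, h.ne'])
      (by intro i _; fin_cases i <;> simpa)
  simpa [Fin.sum_univ_three, ← ‹x = _›] using this

/-! ### Regions enclosed by edges -/

/-- A connected set that meets `K` but not the frontier of `K` is contained in `K`. -/
theorem IsPreconnected.subset_of_frontier {X : Type*} [TopologicalSpace X] {W K : Set X}
    (hW : IsPreconnected W) (hf : Disjoint W (frontier K)) (hn : (W ∩ K).Nonempty) : W ⊆ K := by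
  have hdisj := Set.disjoint_left.1 hf
  obtain ⟨x, hxW, hxK⟩ := hn
  have hint : ∀ y ∈ W, y ∈ K → y ∈ interior K := fun y hy hyK => by
    by_contra h
    exact hdisj hy ⟨subset_closure hyK, h⟩
  have := hW.subset_left_of_subset_union (u := interior K) (v := (closure K)ᶜ) isOpen_interior
    isClosed_closure.isOpen_compl
    (Set.disjoint_left.2 fun y hy hy' => hy' (subset_closure (interior_subset hy)))
    (fun y hy => by
      by_cases hyc : y ∈ closure K
      · left
        by_contra h
        exact hdisj hy ⟨hyc, h⟩
      · exact Or.inr hyc)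
    ⟨x, hxW, hint x hxW hxK⟩
  exact this.trans interior_subset

/-- Points enclosed by the drawing are not in its unbounded component. -/
theorem disjoint_unboundedComponent {K D : Set Plane} (hK : Bornology.IsBounded K)
    (hf : frontier K ⊆ D) : Disjoint K (unboundedComponent D) := by
  refine Set.disjoint_left.2 fun x hxK hx => hx.2 (hK.subset ?_)
  refine isPreconnected_connectedComponentIn.subset_of_frontier ?_
    ⟨x, mem_connectedComponentIn hx.1, hxK⟩
  exact Set.disjoint_left.2 fun y hy hyf => connectedComponentIn_subset _ _ hy (hf hyf)

theorem segment_subset_drawing {V : Type*} {G : SimpleGraph V} {p : V → Plane} {u v : V}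
    (h : G.Adj u v) : segment ℝ (p u) (p v) ⊆ straightLineDrawing G p :=
  fun _ hx => Or.inr ⟨u, v, h, hx⟩

/-- The closed triangle with the (counterclockwise) corners `a b c`. -/
def closedTriangle (a b c : Plane) : Set Plane :=
  {x | 0 ≤ cross a b x ∧ 0 ≤ cross b c x ∧ 0 ≤ cross c a x}

theorem isClosed_closedTriangle (a b c : Plane) : IsClosed (closedTriangle a b c) :=
  (isClosed_le continuous_const (continuous_cross _ _)).inter
    ((isClosed_le continuous_const (continuous_cross _ _)).inter
      (isClosed_le continuous_const (continuous_cross _ _)))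

theorem isBounded_closedTriangle {a b c : Plane} (h : 0 < cross a b c) :
    Bornology.IsBounded (closedTriangle a b c) :=
  (isBounded_convexHull.2 (Set.toFinite {a, b, c}).isBounded).subset
    fun _ hx => mem_convexHull_of_cross h hx.2.1 hx.2.2 hx.1

/-- The union of the two triangles on both sides of the segment `b d` is bounded by the four
segments `a b`, `b c`, `c d`, `d a`. -/
theorem frontier_union_closedTriangle {a b c d : Plane} (h1 : 0 < cross a b d)
    (h2 : 0 < cross b c d) :
    frontier (closedTriangle a b d ∪ closedTriangle b c d) ⊆
      segment ℝ a b ∪ segment ℝ b c ∪ segment ℝ c d ∪ segment ℝ d a := by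
  intro x hx
  have hcl : IsClosed (closedTriangle a b d ∪ closedTriangle b c d) :=
    (isClosed_closedTriangle _ _ _).union (isClosed_closedTriangle _ _ _)
  rw [hcl.frontier_eq] at hx
  obtain ⟨hxK, hxi⟩ := hx
  rw [mem_interior] at hxi
  have ho : ∀ u v : Plane, IsOpen {y | 0 < cross u v y} := fun u v =>
    isOpen_lt continuous_const (continuous_cross u v)
  -- A point strictly to the left of all four sides is interior: nearby points satisfy the same
  -- inequalities and fall into one triangle or the other according to their side of `b d`.
  have key (i1 : 0 < cross a b x) (i2 : 0 < cross b c x) (i3 : 0 < cross c d x)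
      (i4 : 0 < cross d a x) :
      ∃ t ⊆ closedTriangle a b d ∪ closedTriangle b c d, IsOpen t ∧ x ∈ t := by
    refine ⟨_, fun y hy => ?_, ((ho a b).inter (ho b c)).inter ((ho c d).inter (ho d a)),
      ⟨i1, i2⟩, i3, i4⟩
    rcases le_total 0 (cross b d y) with h | h
    · exact Or.inl ⟨hy.1.1.le, h, hy.2.2.le⟩
    · exact Or.inr ⟨hy.1.2.le, hy.2.1.le, by rw [cross_swap]; linarith⟩
  by_contra hno
  simp only [mem_union, not_or] at hno
  obtain ⟨⟨⟨n1, n2⟩, n3⟩, n4⟩ := hno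
  rcases hxK with ⟨p1, p2, p3⟩ | ⟨p1, p2, p3⟩
  · have q1 : 0 < cross a b x := p1.lt_of_ne' fun h => n1 (mem_segment_of_cross h1 p2 p3 h)
    have q3 : 0 < cross d a x := p3.lt_of_ne' fun h =>
      n4 (mem_segment_of_cross (by rwa [← cross_rotate]) p1 p2 h)
    -- On the diagonal, Plücker relations make `x` strictly left of the other two sides as well. Off
    -- the diagonal the open triangle is already a neighbourhood, so the quadrilateral need not be
    -- convex.
    rcases p2.eq_or_lt with q2 | q2
    · have r1 : 0 < cross b c x := by
        have : cross a b d * cross b c x = cross a b x * cross b c d + cross b d x * cross a b c := by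
          unfold cross; ring
        rw [← q2, zero_mul, add_zero] at this
        exact pos_of_mul_pos_right (this ▸ mul_pos q1 h2) h1.le
      have r2 : 0 < cross c d x := by
        have : cross a b d * cross c d x = cross d a x * cross b c d + cross b d x * cross d a c := by
          unfold cross; ring
        rw [← q2, zero_mul, add_zero] at this
        exact pos_of_mul_pos_right (this ▸ mul_pos q3 h2) h1.le
      exact hxi (key q1 r1 r2 q3)
    · exact hxi ⟨_, fun y hy => Or.inl ⟨hy.1.le, hy.2.1.le, hy.2.2.le⟩,
        (ho a b).inter ((ho b d).inter (ho d a)), q1, q2, q3⟩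
  · have q1 : 0 < cross b c x := p1.lt_of_ne' fun h => n2 (mem_segment_of_cross h2 p2 p3 h)
    have q2 : 0 < cross c d x := p2.lt_of_ne' fun h =>
      n3 (mem_segment_of_cross (by rwa [cross_rotate]) p3 p1 h)
    rcases p3.eq_or_lt with q3 | q3
    · have r1 : 0 < cross a b x := by
        have : cross b c d * cross a b x = cross b c x * cross a b d + cross d b x * cross b c a := by
          unfold cross; ring
        rw [← q3, zero_mul, add_zero] at this
        exact pos_of_mul_pos_right (this ▸ mul_pos q1 h1) h2.le
      have r2 : 0 < cross d a x := by
        have : cross b c d * cross d a x = cross c d x * cross a b d + cross d b x * cross c d a := by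
          unfold cross; ring
        rw [← q3, zero_mul, add_zero] at this
        exact pos_of_mul_pos_right (this ▸ mul_pos q2 h1) h2.le
      exact hxi (key r1 q1 q2 r2)
    · exact hxi ⟨_, fun y hy => Or.inr ⟨hy.1.le, hy.2.1.le, hy.2.2.le⟩,
        (ho b c).inter ((ho c d).inter (ho d b)), q1, q2, q3⟩

/-- In an outside-obstacle representation all common neighbours of two non-adjacent vertices lie on
the same side of the line spanned by these two vertices. -/
theorem adj_of_common_neighbors_opposite {V : Type*} {G : SimpleGraph V} {p : V → Plane}
    {C : Set Plane} (hrep : IsObstacleRepresentation G p C)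
    (hC : C ⊆ unboundedComponent (straightLineDrawing G p)) {a b c d : V} (hbd : b ≠ d)
    (hab : G.Adj a b) (had : G.Adj a d) (hcb : G.Adj c b) (hcd : G.Adj c d)
    (h1 : 0 < cross (p a) (p b) (p d)) (h2 : 0 < cross (p b) (p c) (p d)) : G.Adj b d := by
  refine (hrep.2.2.2 b d).2 ⟨hbd, ?_⟩
  have hf : frontier (closedTriangle (p a) (p b) (p d) ∪ closedTriangle (p b) (p c) (p d)) ⊆
      straightLineDrawing G p :=
    (frontier_union_closedTriangle h1 h2).trans <|
      Set.union_subset (Set.union_subset (Set.union_subset (segment_subset_drawing hab)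
        (segment_subset_drawing hcb.symm)) (segment_subset_drawing hcd))
        (segment_subset_drawing had.symm)
  have hdis := disjoint_unboundedComponent
    ((isBounded_closedTriangle h1).union (isBounded_closedTriangle h2)) hf
  refine (hdis.mono_right hC).mono_left fun x hx => Or.inl ?_
  refine ⟨?_, segment_subset_cross_nonneg (cross_self_left _ _).ge (cross_self_right _ _).ge hx, ?_⟩
  · exact segment_subset_cross_nonneg (cross_self_right _ _).ge h1.le hx
  · exact segment_subset_cross_nonneg (by rw [← cross_rotate]; exact h1.le)
      (cross_self_left _ _).ge hx

/-! ### Obstacles between a piecewise affine graph and a horizontal line -/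

theorem mem_segment_graph {a b α β : ℝ} (hab : a < b) (q : Plane) :
    q ∈ segment ℝ !₂[a, α] !₂[b, β] ↔
      q 0 ∈ Icc a b ∧ q 1 = α + (β - α) / (b - a) * (q 0 - a) := by
  have hba : 0 < b - a := sub_pos.2 hab
  rw [segment_eq_image]
  constructor
  · rintro ⟨t, ⟨h0, h1⟩, rfl⟩
    simp only [PiLp.add_apply, PiLp.smul_apply, smul_eq_mul, mem_Icc]
    simp only [Matrix.cons_val_zero, Matrix.cons_val_one, Matrix.cons_val_fin_one]
    refine ⟨⟨by nlinarith, by nlinarith⟩, ?_⟩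
    field_simp
    ring
  · rintro ⟨⟨h0, h1⟩, h⟩
    refine ⟨(q 0 - a) / (b - a), ⟨by have := sub_nonneg.2 h0; positivity,
      (div_le_one hba).2 (by linarith)⟩, Plane.ext' ?_ ?_⟩
    · simp only [PiLp.add_apply, PiLp.smul_apply, smul_eq_mul]
      simp only [Matrix.cons_val_zero]
      field_simp
      ring
    · simp only [PiLp.add_apply, PiLp.smul_apply, smul_eq_mul]
      simp only [Matrix.cons_val_one, Matrix.cons_val_fin_one]
      rw [h]
      field_simp
      ring

section Comb

/-- The continuous function `f` is affine on the intervals of the subdivision `n 0 < … < n m`,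
less than `M` inside and equal to `M` outside of `(n 0, n m)`. -/
structure IsComb (f : ℝ → ℝ) (M : ℝ) (n : ℕ → ℝ) (m : ℕ) : Prop where
  two_le : 2 ≤ m
  lt_succ : ∀ i < m, n i < n (i + 1)
  continuous : Continuous f
  affine : ∀ i < m, ∀ x ∈ Icc (n i) (n (i + 1)),
    f x = f (n i) + (f (n (i + 1)) - f (n i)) / (n (i + 1) - n i) * (x - n i)
  lt : ∀ x ∈ Ioo (n 0) (n m), f x < M
  eq : ∀ x ∉ Ioo (n 0) (n m), f x = M

variable {f : ℝ → ℝ} {M : ℝ} {n : ℕ → ℝ} {m : ℕ}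

theorem subdivision_lt (hn : ∀ i < m, n i < n (i + 1)) {i j : ℕ} (hij : i < j) (hj : j ≤ m) :
    n i < n j := by
  induction j, hij using Nat.le_induction with
  | base => exact hn i hj
  | succ j hij ih => exact (ih (by lia)).trans (hn j hj)

theorem exists_mem_subdivision (hn : ∀ i < m, n i < n (i + 1)) {x : ℝ} (hm : m ≠ 0)
    (hx : x ∈ Icc (n 0) (n m)) : ∃ i < m, x ∈ Icc (n i) (n (i + 1)) := by
  induction m with
  | zero => exact absurd rfl hm
  | succ m ih =>
    rcases le_total (n m) x with h | h
    · exact ⟨m, by lia, h, hx.2⟩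
    · rcases Nat.eq_zero_or_pos m with rfl | h0
      · exact ⟨0, by lia, hx⟩
      · obtain ⟨i, hi, hxi⟩ := ih (fun i hi => hn i (by lia)) h0.ne' ⟨hx.1, h⟩
        exact ⟨i, by lia, hxi⟩

/-- The region between the graph of `f` and the horizontal line at height `M`. -/
def combRegion (f : ℝ → ℝ) (M : ℝ) : Set Plane := {q | f (q 0) < q 1 ∧ q 1 < M}

/-- The polygon whose vertices are the points of the graph of `f` over the subdivision. -/
noncomputable def combPolygon (f : ℝ → ℝ) (n : ℕ → ℝ) (m : ℕ) : Polygon Plane (m + 1) :=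
  ⟨fun i => !₂[n i, f (n i)]⟩

namespace IsComb

variable (h : IsComb f M n m)
include h

theorem n_lt {i j : ℕ} (hij : i < j) (hj : j ≤ m) : n i < n j := subdivision_lt h.lt_succ hij hj

theorem n_le {i j : ℕ} (hij : i ≤ j) (hj : j ≤ m) : n i ≤ n j := by
  rcases hij.eq_or_lt with rfl | hij
  · exact le_rfl
  · exact (h.n_lt hij hj).le

theorem le (x : ℝ) : f x ≤ M := by
  by_cases hx : x ∈ Ioo (n 0) (n m)
  · exact (h.lt x hx).le
  · exact (h.eq x hx).le

theorem eq_iff {x : ℝ} (hx : x ∈ Icc (n 0) (n m)) : f x = M ↔ x = n 0 ∨ x = n m := by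
  constructor
  · intro hf
    by_contra! hne
    exact (h.lt x ⟨lt_of_le_of_ne hx.1 hne.1.symm, lt_of_le_of_ne hx.2 hne.2⟩).ne hf
  · rintro (rfl | rfl) <;> exact h.eq _ (by simp)

theorem mem_edgeSet_castSucc (i : Fin m) (q : Plane) :
    q ∈ (combPolygon f n m).edgeSet ℝ i.castSucc ↔
      q 0 ∈ Icc (n i) (n (i + 1)) ∧ q 1 = f (q 0) := by
  have hi : finRotate (m + 1) i.castSucc = i.succ := finRotate_of_lt i.2
  rw [Polygon.edgeSet, hi, affineSegment_eq_segment]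
  simp only [combPolygon, Fin.val_castSucc, Fin.val_succ]
  rw [mem_segment_graph (h.lt_succ i i.2)]
  exact and_congr_right fun hq => by rw [h.affine i i.2 _ hq]

/-- The closing edge is horizontal because `f` equals `M` at both end nodes. -/
theorem mem_edgeSet_last (q : Plane) :
    q ∈ (combPolygon f n m).edgeSet ℝ (Fin.last m) ↔ q 0 ∈ Icc (n 0) (n m) ∧ q 1 = M := by
  have h0 : f (n 0) = M := h.eq _ (by simp)
  have hm : f (n m) = M := h.eq _ (by simp)
  rw [Polygon.edgeSet, finRotate_last, affineSegment_eq_segment, segment_symm]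
  simp only [combPolygon, Fin.val_zero, Fin.val_last, h0, hm]
  rw [mem_segment_graph (h.n_lt (by have := h.two_le; lia) le_rfl)]
  simp

theorem boundary_eq : (combPolygon f n m).boundary ℝ =
    {q | q 0 ∈ Icc (n 0) (n m) ∧ (q 1 = f (q 0) ∨ q 1 = M)} := by
  ext q
  simp only [Polygon.boundary, mem_iUnion, mem_ofPred_eq]
  constructor
  · rintro ⟨i, hi⟩
    induction i using Fin.lastCases with
    | last => rw [h.mem_edgeSet_last] at hi; exact ⟨hi.1, Or.inr hi.2⟩
    | cast i =>
      rw [h.mem_edgeSet_castSucc] at hi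
      exact ⟨⟨(h.n_le (by lia) (by lia)).trans hi.1.1, hi.1.2.trans (h.n_le (by lia) le_rfl)⟩,
        Or.inl hi.2⟩
  · rintro ⟨hq, h1 | h1⟩
    · obtain ⟨i, hi, hqi⟩ := exists_mem_subdivision h.lt_succ (by have := h.two_le; lia) hq
      exact ⟨Fin.castSucc ⟨i, hi⟩, (h.mem_edgeSet_castSucc _ _).2 ⟨hqi, h1⟩⟩
    · exact ⟨Fin.last m, (h.mem_edgeSet_last _).2 ⟨hq, h1⟩⟩

/-- All edges but the last project onto consecutive intervals of the subdivision, so among them only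
neighbours meet. The last edge has height `M`, which the graph attains over the subdivision only at
its two ends. The bound `2 ≤ m` provides the third vertex. -/
theorem polygonIsSimple : PolygonIsSimple (combPolygon f n m) := by
  have h2 := h.two_le
  refine ⟨by lia, ?_, ?_, ?_⟩
  · intro i heq
    have h0 : n i = n (finRotate (m + 1) i) := by
      simpa [combPolygon] using congrArg (fun q : Plane => q 0) heq
    induction i using Fin.lastCases with
    | last =>
      rw [finRotate_last] at h0
      exact (h.n_lt (i := 0) (by lia) le_rfl).ne' (by simpa using h0)
    | cast i =>
      rw [show finRotate (m + 1) i.castSucc = i.succ from finRotate_of_lt i.2] at h0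
      exact (h.lt_succ i i.2).ne (by simpa using h0)
  · intro i
    ext q
    induction i using Fin.lastCases with
    | last =>
      rw [finRotate_last, mem_inter_iff, h.mem_edgeSet_last,
        show (0 : Fin (m + 1)) = Fin.castSucc ⟨0, by lia⟩ from rfl, h.mem_edgeSet_castSucc]
      have h0 : f (n 0) = M := h.eq _ (by simp)
      simp only [mem_singleton_iff, combPolygon, Fin.castSucc_mk, zero_add]
      constructor
      · rintro ⟨⟨hq, h1⟩, hq', h1'⟩
        rcases (h.eq_iff hq).1 (h1'.symm.trans h1) with e | e
        · exact Plane.ext' (by simpa using e) (by simp [h1, h0])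
        · exact absurd hq'.2 (by rw [e]; exact (h.n_lt (by lia) le_rfl).not_ge)
      · rintro rfl
        simp [h0, (h.lt_succ 0 (by lia)).le, h.n_le (i := 0) (j := m) (by lia) le_rfl]
    | cast i =>
      rw [show finRotate (m + 1) i.castSucc = i.succ from finRotate_of_lt i.2, mem_inter_iff,
        h.mem_edgeSet_castSucc]
      by_cases hi : (i : ℕ) + 1 = m
      · have hl : i.succ = Fin.last m := Fin.ext hi
        have hm : f (n m) = M := h.eq _ (by simp)
        rw [hl, h.mem_edgeSet_last, hi]
        simp only [mem_singleton_iff, combPolygon, Fin.val_last]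
        constructor
        · rintro ⟨⟨hq, h1⟩, hq', h1'⟩
          rcases (h.eq_iff hq').1 (h1.symm.trans h1') with e | e
          · exact absurd hq.1 (by rw [e]; exact (h.n_lt (by lia) (by lia)).not_ge)
          · exact Plane.ext' (by simpa using e) (by simp [h1', hm])
        · rintro rfl
          simp [hm, h.n_le (i := i) (j := m) (by lia) le_rfl,
            h.n_le (i := 0) (j := m) (by lia) le_rfl]
      · rw [show i.succ = Fin.castSucc ⟨i + 1, by lia⟩ from rfl, h.mem_edgeSet_castSucc]
        simp only [mem_singleton_iff, combPolygon, Fin.castSucc_mk]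
        constructor
        · rintro ⟨⟨hq, h1⟩, hq', h1'⟩
          have e : q 0 = n (i + 1) := le_antisymm hq.2 hq'.1
          exact Plane.ext' (by simpa using e) (by simp [h1, e])
        · rintro rfl
          simp [h.n_le (i := i) (j := i + 1) (by lia) (by lia),
            h.n_le (i := i + 1) (j := i + 1 + 1) (by lia) (by lia)]
  · have key : ∀ i j : Fin (m + 1), i < j → j ≠ finRotate (m + 1) i → i ≠ finRotate (m + 1) j →
        Disjoint ((combPolygon f n m).edgeSet ℝ i) ((combPolygon f n m).edgeSet ℝ j) := by
      intro i j hij h1 h2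
      rw [Set.disjoint_left]
      intro q hi hj
      induction i using Fin.lastCases with
      | last => exact absurd hij (Fin.le_last j).not_gt
      | cast i =>
      rw [show finRotate (m + 1) i.castSucc = i.succ from finRotate_of_lt i.2] at h1
      rw [h.mem_edgeSet_castSucc] at hi
      induction j using Fin.lastCases with
      | last =>
        rw [h.mem_edgeSet_last] at hj
        rw [finRotate_last] at h2
        have hi0 : (i : ℕ) ≠ 0 := fun h0 => h2 (Fin.ext h0)
        have him : (i : ℕ) + 1 ≠ m := fun h0 => h1 (Fin.ext h0.symm)
        rcases (h.eq_iff hj.1).1 (hi.2.symm.trans hj.2) with e | e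
        · exact absurd hi.1.1 (by rw [e]; exact (h.n_lt (by lia) (by lia)).not_ge)
        · exact absurd hi.1.2 (by rw [e]; exact (h.n_lt (by lia) (by lia)).not_ge)
      | cast j =>
        rw [h.mem_edgeSet_castSucc] at hj
        have hij' : (i : ℕ) < j := hij
        have hne : (j : ℕ) ≠ i + 1 := fun h0 => h1 (Fin.ext h0)
        exact absurd (hj.1.1.trans hi.1.2) (h.n_lt (by lia) (by lia)).not_ge
    intro i j hij h1 h2
    rcases hij.lt_or_gt with hlt | hlt
    · exact key i j hlt h1 h2
    · exact (key j i hlt h2 h1).symm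

theorem continuous_comp_fst : Continuous fun q : Plane => f (q 0) :=
  h.continuous.comp (by fun_prop)

theorem isOpen_combRegion : IsOpen (combRegion f M) :=
  have h1 : Continuous fun q : Plane => q 1 := by fun_prop
  (isOpen_lt h.continuous_comp_fst h1).inter (isOpen_lt h1 continuous_const)

theorem combRegion_subset {q : Plane} (hq : q ∈ combRegion f M) : q 0 ∈ Ioo (n 0) (n m) := by
  by_contra hn
  exact (hq.1.trans hq.2).ne (h.eq _ hn)

end IsComb

/-- Interpolation between the graph of `f` and the line at height `M`. -/
noncomputable def combChart (f : ℝ → ℝ) (M : ℝ) (z : ℝ × ℝ) : Plane :=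
  !₂[z.1, f z.1 + z.2 * (M - f z.1)]

namespace IsComb

variable (h : IsComb f M n m)
include h

theorem continuous_combChart : Continuous (combChart f M) := by
  have := h.continuous
  refine (PiLp.continuous_toLp 2 _).comp (continuous_pi fun i => ?_)
  fin_cases i <;> simp <;> fun_prop

theorem image_combChart : combChart f M '' (Ioo (n 0) (n m) ×ˢ Ioo 0 1) = combRegion f M := by
  ext q
  constructor
  · rintro ⟨⟨x, s⟩, ⟨hx, hs⟩, rfl⟩
    have := h.lt x hx
    have h1 : 0 < s := hs.1
    have h2 : s < 1 := hs.2
    simp only [combRegion, combChart, mem_ofPred_eq, Matrix.cons_val_zero,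
      Matrix.cons_val_one, Matrix.cons_val_fin_one]
    constructor <;> nlinarith
  · intro hq
    have hx := h.combRegion_subset hq
    have hpos : 0 < M - f (q 0) := sub_pos.2 (h.lt _ hx)
    refine ⟨(q 0, (q 1 - f (q 0)) / (M - f (q 0))),
      ⟨hx, div_pos (sub_pos.2 hq.1) hpos, (div_lt_one hpos).2 (by linarith [hq.2])⟩,
      Plane.ext' (by simp [combChart]) ?_⟩
    simp [combChart, hpos.ne']

theorem closure_combRegion : closure (combRegion f M) =
    {q | q 0 ∈ Icc (n 0) (n m) ∧ f (q 0) ≤ q 1 ∧ q 1 ≤ M} := by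
  have hlt : n 0 < n m := h.n_lt (by have := h.two_le; lia) le_rfl
  apply subset_antisymm
  · refine closure_minimal (fun q hq => ⟨Ioo_subset_Icc_self (h.combRegion_subset hq), hq.1.le,
      hq.2.le⟩) ?_
    have h1 : Continuous fun q : Plane => q 1 := by fun_prop
    exact (isClosed_Icc.preimage (by fun_prop : Continuous fun q : Plane => q 0)).inter
      ((isClosed_le h.continuous_comp_fst h1).inter (isClosed_le h1 continuous_const))
  · rintro q ⟨hx, h1, h2⟩
    have hsub := image_closure_subset_closure_image h.continuous_combChart
      (s := Ioo (n 0) (n m) ×ˢ Ioo 0 1)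
    rw [h.image_combChart, closure_prod_eq, closure_Ioo hlt.ne, closure_Ioo zero_ne_one] at hsub
    apply hsub
    -- Where the graph touches height `M` the fibre of the chart collapses to a point and the
    -- parameter is arbitrary.
    rcases (h.le (q 0)).eq_or_lt with e | e
    · refine ⟨(q 0, 0), ⟨hx, by simp⟩, Plane.ext' (by simp [combChart]) ?_⟩
      simp [combChart]; linarith
    · have hpos : 0 < M - f (q 0) := sub_pos.2 e
      refine ⟨(q 0, (q 1 - f (q 0)) / (M - f (q 0))),
        ⟨hx, div_nonneg (sub_nonneg.2 h1) hpos.le, (div_le_one hpos).2 (by linarith)⟩,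
        Plane.ext' (by simp [combChart]) ?_⟩
      simp [combChart, hpos.ne']

/-- The chart maps an open rectangle onto the region, which gives connectedness, and boundedness by
compactness of the closed rectangle. Removing the open region from its closure leaves the graph and
the horizontal top, that is, the polygon. -/
theorem isOpenSimplePolygon : IsOpenSimplePolygon (combRegion f M) := by
  have hlt : n 0 < n m := h.n_lt (by have := h.two_le; lia) le_rfl
  refine ⟨h.isOpen_combRegion, ?_, ?_, m + 1, combPolygon f n m, h.polygonIsSimple, ?_⟩
  · rw [← h.image_combChart]
    exact ((isConnected_Ioo hlt).prod (isConnected_Ioo zero_lt_one)).image _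
      h.continuous_combChart.continuousOn
  · rw [← h.image_combChart]
    refine ((isCompact_Icc.prod isCompact_Icc).image h.continuous_combChart).isBounded.subset
      (image_mono (prod_mono Ioo_subset_Icc_self Ioo_subset_Icc_self))
  · rw [h.boundary_eq, frontier, h.isOpen_combRegion.interior_eq, h.closure_combRegion]
    ext q
    simp only [combRegion, Set.mem_sdiff, mem_ofPred_eq, not_and, not_lt]
    constructor
    · rintro ⟨⟨hx, h1, h2⟩, h3⟩
      refine ⟨hx, ?_⟩
      rcases h1.eq_or_lt with e | e
      · exact Or.inl e.symm
      · exact Or.inr (le_antisymm h2 (h3 e))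
    · rintro ⟨hx, e | e⟩
      · exact ⟨⟨hx, e.ge, e ▸ h.le _⟩, fun hh => absurd e hh.ne'⟩
      · exact ⟨⟨hx, e ▸ h.le _, e.le⟩, fun _ => e.ge⟩

/-- The region above the whole graph is connected and unbounded; it joins the obstacle to infinity.
-/
theorem isPreconnected_above : IsPreconnected {q : Plane | f (q 0) < q 1} := by
  have hc : Continuous fun z : ℝ × ℝ => (!₂[z.1, f z.1 + z.2] : Plane) := by
    have := h.continuous
    refine (PiLp.continuous_toLp 2 _).comp (continuous_pi fun i => ?_)
    fin_cases i <;> simp <;> fun_prop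
  have : {q : Plane | f (q 0) < q 1} =
      (fun z : ℝ × ℝ => (!₂[z.1, f z.1 + z.2] : Plane)) '' (univ ×ˢ Ioi 0) := by
    ext q
    constructor
    · intro hq
      exact ⟨(q 0, q 1 - f (q 0)), ⟨trivial, by simpa using hq⟩, Plane.ext' (by simp) (by simp)⟩
    · rintro ⟨⟨x, s⟩, ⟨-, hs⟩, rfl⟩
      simpa using hs
  rw [this]
  exact (isPreconnected_univ.prod isPreconnected_Ioi).image _ hc.continuousOn

/-- If the drawing lies below the graph of `f`, then the region above the graph is contained in
the unbounded component. -/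
theorem combRegion_subset_unboundedComponent {D : Set Plane} (hD : ∀ q ∈ D, q 1 ≤ f (q 0)) :
    combRegion f M ⊆ unboundedComponent D := by
  have hsub : {q : Plane | f (q 0) < q 1} ⊆ Dᶜ := fun q hq hqD => (hD q hqD).not_gt hq
  intro q hq
  refine ⟨hsub hq.1, fun hb => ?_⟩
  have := hb.subset (h.isPreconnected_above.subset_connectedComponentIn hq.1 hsub)
  obtain ⟨R, hR⟩ := this.exists_norm_le
  have hmem : (!₂[0, max (R + 1) (f 0 + 1)] : Plane) ∈ {q : Plane | f (q 0) < q 1} := by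
    simp
  have h2 := PiLp.norm_apply_le (!₂[0, max (R + 1) (f 0 + 1)] : Plane) 1
  have h3 := h2.trans (hR _ hmem)
  have h4 := (le_abs_self _).trans (Real.norm_eq_abs _ ▸ h3)
  simp at h4
  linarith

end IsComb

end Comb

/-- Each induction step adds a ramp that is constant outside the new interval: a linear function of
`x` clamped to that interval. -/
theorem exists_interpolation {n : ℕ → ℝ} (g : ℕ → ℝ) {m : ℕ} (hn : ∀ i < m, n i < n (i + 1)) :
    ∃ f : ℝ → ℝ, Continuous f ∧ (∀ x ≤ n 0, f x = g 0) ∧ (∀ x ≥ n m, f x = g m) ∧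
      ∀ i < m, ∀ x ∈ Icc (n i) (n (i + 1)),
        f x = g i + (g (i + 1) - g i) / (n (i + 1) - n i) * (x - n i) := by
  induction m with
  | zero => exact ⟨fun _ => g 0, continuous_const, by simp, by simp, by simp⟩
  | succ m ih =>
    obtain ⟨f, hf, h0, hm, hi⟩ := ih fun i hi => hn i (by lia)
    have hlt := hn m (by lia)
    have h0m : n 0 ≤ n m := by
      rcases Nat.eq_zero_or_pos m with rfl | h
      · exact le_rfl
      · exact (subdivision_lt (fun i hi => hn i hi) h (by lia)).le
    refine ⟨fun x => f x + (g (m + 1) - g m) / (n (m + 1) - n m) *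
      (max (n m) (min x (n (m + 1))) - n m), by fun_prop, ?_, ?_, ?_⟩
    · intro x hx
      dsimp only
      rw [h0 x hx, min_eq_left (by linarith), max_eq_left (by linarith)]
      ring
    · intro x hx
      dsimp only
      rw [hm x (by linarith), min_eq_right hx, max_eq_right hlt.le]
      have : n (m + 1) - n m ≠ 0 := (sub_pos.2 hlt).ne'
      field_simp
      ring
    · intro i him x hx
      dsimp only
      rcases (Nat.lt_succ_iff.1 him).eq_or_lt with rfl | him'
      · rw [hm x hx.1, min_eq_left hx.2, max_eq_right hx.1]
      · have : n (i + 1) ≤ n m := by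
          rcases (Nat.succ_le_of_lt him').eq_or_lt with h | h
          · exact (congrArg n h).le
          · exact (subdivision_lt (fun i hi => hn i hi) h (by lia)).le
        rw [hi i him' x hx, min_eq_left (by linarith [hx.2]), max_eq_left (by linarith [hx.2])]
        ring

/-- A comb with prescribed values on a finite set. -/
theorem exists_isComb {N : Finset ℝ} {val : ℝ → ℝ} {M L R c : ℝ} (hL : L ∈ N) (hR : R ∈ N)
    (hc : c ∈ N) (hcI : c ∈ Ioo L R) (hN : ∀ x ∈ N, x ∈ Icc L R) (hvL : val L = M)
    (hvR : val R = M) (hv : ∀ x ∈ N, x ∈ Ioo L R → val x < M) :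
    ∃ (f : ℝ → ℝ) (n : ℕ → ℝ) (m : ℕ), IsComb f M n m ∧ (∀ x ∈ N, f x = val x) ∧
      n 0 = L ∧ n m = R ∧ (∀ i ≤ m, n i ∈ N) ∧ ∀ i < m, ∀ x ∈ N, x ∉ Ioo (n i) (n (i + 1)) := by
  classical
  obtain ⟨m, hm⟩ : ∃ m, N.card = m + 1 :=
    Nat.exists_eq_succ_of_ne_zero (Finset.card_ne_zero_of_mem hL)
  have hm2 : 2 ≤ m := by
    have : ({L, c, R} : Finset ℝ) ⊆ N := by
      intro x hx
      simp only [Finset.mem_insert, Finset.mem_singleton] at hx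
      rcases hx with rfl | rfl | rfl <;> assumption
    have h3 := Finset.card_le_card this
    rw [Finset.card_eq_three.2 ⟨L, c, R, hcI.1.ne, (hcI.1.trans hcI.2).ne, hcI.2.ne, rfl⟩] at h3
    lia
  set e := N.orderEmbOfFin hm with he
  set n : ℕ → ℝ := fun i => if h : i < m + 1 then e ⟨i, h⟩ else 0 with hn
  have hni : ∀ i (h : i < m + 1), n i = e ⟨i, h⟩ := fun i h => dif_pos h
  have hnN : ∀ i < m + 1, n i ∈ N := fun i h => by
    rw [hni i h]; exact Finset.orderEmbOfFin_mem _ _ _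
  have hex : ∀ x ∈ N, ∃ i < m + 1, n i = x := fun x hx => by
    have : x ∈ Set.range e := by rw [he, Finset.range_orderEmbOfFin]; exact hx
    obtain ⟨i, rfl⟩ := this
    exact ⟨i, i.2, hni i i.2⟩
  have hmono : ∀ i j, i < j → j < m + 1 → n i < n j := fun i j hij hj => by
    rw [hni i (hij.trans hj), hni j hj]; exact e.strictMono hij
  have hlt : ∀ i < m, n i < n (i + 1) := fun i hi => hmono _ _ (by lia) (by lia)
  have hn0 : n 0 = L := by
    obtain ⟨i, hi, hiL⟩ := hex L hL
    rcases Nat.eq_zero_or_pos i with rfl | h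
    · exact hiL
    · exact absurd ((hN _ (hnN 0 (by lia))).1) (by rw [← hiL]; exact (hmono 0 i h hi).not_ge)
  have hnm : n m = R := by
    obtain ⟨i, hi, hiR⟩ := hex R hR
    rcases (Nat.lt_succ_iff.1 hi).eq_or_lt with rfl | h
    · exact hiR
    · exact absurd ((hN _ (hnN m (by lia))).2) (by rw [← hiR]; exact (hmono i m h (by lia)).not_ge)
  obtain ⟨f, hf, hf0, hfm, hfi⟩ := exists_interpolation (fun i => val (n i)) hlt
  have hfn : ∀ i < m + 1, f (n i) = val (n i) := fun i hi => by
    rcases (Nat.lt_succ_iff.1 hi).eq_or_lt with rfl | h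
    · exact hfm _ le_rfl
    · rw [hfi i h _ ⟨le_rfl, (hlt i h).le⟩]; simp
  have hval : ∀ i < m + 1, val (n i) ≤ M ∧ (0 < i → i < m → val (n i) < M) := fun i hi => by
    have hlt' : 0 < i → i < m → val (n i) < M := fun h0 h1 =>
      hv _ (hnN i hi) ⟨hn0 ▸ hmono 0 i h0 hi, hnm ▸ hmono i m h1 (by lia)⟩
    refine ⟨?_, hlt'⟩
    rcases Nat.eq_zero_or_pos i with rfl | h
    · rw [hn0, hvL]
    · rcases (Nat.lt_succ_iff.1 hi).eq_or_lt with rfl | h'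
      · rw [hnm, hvR]
      · exact (hlt' h h').le
  refine ⟨f, n, m, ⟨hm2, hlt, hf, ?_, ?_, ?_⟩, ?_, hn0, hnm,
    fun i hi => hnN i (Nat.lt_succ_of_le hi), ?_⟩
  · intro i hi x hx
    rw [hfi i hi x hx, hfn i (by lia), hfn (i + 1) (by lia)]
  · intro x hx
    obtain ⟨i, hi, hxi⟩ := exists_mem_subdivision hlt (by lia) (Ioo_subset_Icc_self hx)
    have hd := sub_pos.2 (hlt i hi)
    have e1 : f x = ((n (i + 1) - x) * val (n i) + (x - n i) * val (n (i + 1))) /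
        (n (i + 1) - n i) := by
      rw [hfi i hi x hxi]; field_simp; ring
    rw [e1, div_lt_iff₀ hd]
    have a1 := (hval i (by lia)).1
    have a2 := (hval (i + 1) (by lia)).1
    have b1 := sub_nonneg.2 hxi.1
    have b2 := sub_nonneg.2 hxi.2
    -- `f x` is a weighted mean of two node values, at most `M` each, so one smaller value of
    -- positive weight suffices. On the first piece only the right node can supply it; it is not the
    -- last node since `2 ≤ m`.
    rcases Nat.eq_zero_or_pos i with rfl | h0
    · have h1 := (hval 1 (by lia)).2 (by lia) (by lia)
      have h2 : 0 < x - n 0 := sub_pos.2 hx.1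
      rw [zero_add] at *
      nlinarith [mul_le_mul_of_nonneg_left a1 b2, mul_lt_mul_of_pos_left h1 h2]
    · have h1 := (hval i (by lia)).2 h0 hi
      rcases hxi.2.eq_or_lt with h2 | h2
      · have : i + 1 < m := by
          by_contra hh
          have : i + 1 = m := by lia
          rw [this] at h2
          exact hx.2.ne h2
        have h3 := (hval (i + 1) (by lia)).2 (by lia) this
        nlinarith [mul_le_mul_of_nonneg_left a1 b2,
          mul_lt_mul_of_pos_left h3 (by linarith : 0 < x - n i)]
      · nlinarith [mul_le_mul_of_nonneg_left a2 b1, mul_lt_mul_of_pos_left h1 (sub_pos.2 h2)]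
  · intro x hx
    rcases le_or_gt x (n 0) with h | h
    · rw [hf0 x h, hn0, hvL]
    · rw [hfm x (not_lt.1 fun hh => hx ⟨h, hh⟩), hnm, hvR]
  · intro x hx
    obtain ⟨i, hi, rfl⟩ := hex x hx
    exact hfn i hi
  · rintro i hi x hx ⟨h1, h2⟩
    obtain ⟨j, hj, rfl⟩ := hex x hx
    rcases lt_or_ge i j with h | h
    · rcases (Nat.succ_le_of_lt h).eq_or_lt with h' | h'
      · exact h2.ne (congrArg n h').symm
      · exact (hmono _ _ h' hj).not_gt h2
    · rcases h.eq_or_lt with rfl | h'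
      · exact h1.ne rfl
      · exact (hmono _ _ h' (by lia)).not_gt h1

/-! ### Hanging a comb over a drawing -/

/-- The height over `t` of the line through `a` and `b`. -/
noncomputable def chord (a b : Plane) (t : ℝ) : ℝ := a 1 + (b 1 - a 1) / (b 0 - a 0) * (t - a 0)

theorem mem_segment_iff_chord {a b : Plane} (hab : a 0 < b 0) (q : Plane) :
    q ∈ segment ℝ a b ↔ q 0 ∈ Icc (a 0) (b 0) ∧ q 1 = chord a b (q 0) := by
  have ha : a = !₂[a 0, a 1] := Plane.ext' (by simp) (by simp)
  have hb : b = !₂[b 0, b 1] := Plane.ext' (by simp) (by simp)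
  rw [ha, hb, mem_segment_graph (by simpa using hab)]
  simp [chord]

theorem chord_lt {a b : Plane} {t M : ℝ} (hab : a 0 < b 0) (ht : t ∈ Icc (a 0) (b 0))
    (ha : a 1 < M) (hb : b 1 < M) : chord a b t < M := by
  have hd := sub_pos.2 hab
  have : chord a b t = ((b 0 - t) * a 1 + (t - a 0) * b 1) / (b 0 - a 0) := by
    unfold chord; field_simp; ring
  rw [this, div_lt_iff₀ hd]
  have h1 := sub_nonneg.2 ht.1
  have h2 := sub_nonneg.2 ht.2
  rcases h1.eq_or_lt with h | h
  · nlinarith [mul_le_mul_of_nonneg_left hb.le h1,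
      mul_lt_mul_of_pos_left ha (by linarith : 0 < b 0 - t)]
  · nlinarith [mul_le_mul_of_nonneg_left ha.le h2, mul_lt_mul_of_pos_left hb h]

/-- An affine function that is at most `f` at all prescribed points of its domain is at most
`f`. -/
theorem IsComb.chord_le {f : ℝ → ℝ} {M : ℝ} {n : ℕ → ℝ} {m : ℕ} (h : IsComb f M n m)
    {a b : Plane} (ha : n 0 ≤ a 0) (hb : b 0 ≤ n m)
    (hna : ∀ i < m, a 0 ∉ Ioo (n i) (n (i + 1))) (hnb : ∀ i < m, b 0 ∉ Ioo (n i) (n (i + 1)))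
    (hle : ∀ i ≤ m, n i ∈ Icc (a 0) (b 0) → chord a b (n i) ≤ f (n i)) {x : ℝ}
    (hx : x ∈ Icc (a 0) (b 0)) : chord a b x ≤ f x := by
  obtain ⟨i, hi, hxi⟩ := exists_mem_subdivision h.lt_succ (by have := h.two_le; lia)
    (show x ∈ Icc (n 0) (n m) from ⟨ha.trans hx.1, hx.2.trans hb⟩)
  have hlt := h.lt_succ i hi
  rcases hxi.1.eq_or_lt with e | e
  · rw [← e] at hx ⊢; exact hle i hi.le hx
  rcases hxi.2.eq_or_lt with e' | e'
  · rw [e'] at hx ⊢; exact hle (i + 1) hi hx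
  have h1 : a 0 ≤ n i := not_lt.1 fun hh => hna i hi ⟨hh, hx.1.trans_lt e'⟩
  have h2 : n (i + 1) ≤ b 0 := not_lt.1 fun hh => hnb i hi ⟨e.trans_le hx.2, hh⟩
  have i1 := hle i hi.le ⟨h1, hlt.le.trans h2⟩
  have i2 := hle (i + 1) hi ⟨h1.trans hlt.le, h2⟩
  rw [h.affine i hi x hxi]
  have hd := sub_pos.2 hlt
  have e1 : f (n i) + (f (n (i + 1)) - f (n i)) / (n (i + 1) - n i) * (x - n i) =
      ((n (i + 1) - x) * f (n i) + (x - n i) * f (n (i + 1))) / (n (i + 1) - n i) := by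
    field_simp; ring
  rw [e1, le_div_iff₀ hd]
  have e2 : chord a b x * (n (i + 1) - n i) =
      (n (i + 1) - x) * chord a b (n i) + (x - n i) * chord a b (n (i + 1)) := by
    unfold chord; ring
  rw [e2]
  have := sub_nonneg.2 hxi.1
  have := sub_nonneg.2 hxi.2
  gcongr

/-- A placement of the vertices such that for any two non-adjacent vertices, the segment between
them lies strictly above all edges at some place yields an outside obstacle from above. -/
theorem hasOutsideObstacleRepresentation_of_exposed {V : Type*} [Finite V] [Nonempty V]
    {G : SimpleGraph V} {p : V → Plane} (hp : InGeneralPosition p)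
    (hx : ∀ u v, u ≠ v → p u 0 ≠ p v 0)
    (hexp : ∀ u v, p u 0 < p v 0 → ¬ G.Adj u v → ∃ t ∈ Ioo (p u 0) (p v 0), (∀ w, p w 0 ≠ t) ∧
      ∀ a b, G.Adj a b → t ∈ Ioo (p a 0) (p b 0) → chord (p a) (p b) t < chord (p u) (p v) t) :
    HasOutsideObstacleRepresentation G := by
  classical
  have := Fintype.ofFinite V
  choose! τ hτ using hexp
  -- the height of the obstacle between its spikes
  obtain ⟨M₀, hM₀⟩ : ∃ M₀, ∀ v, p v 1 < M₀ := by
    obtain ⟨B, hB⟩ := (Set.finite_range fun v => p v 1).bddAbove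
    exact ⟨B + 1, fun v => by linarith [hB ⟨v, rfl⟩]⟩
  obtain ⟨B, hB⟩ := (Set.finite_range fun v => |p v 0|).bddAbove
  have hB' : ∀ v, p v 0 ∈ Ioo (-(B + 1)) (B + 1) := fun v => by
    have := abs_le.1 (hB ⟨v, rfl⟩)
    constructor <;> linarith [this.1, this.2]
  -- the height of the spikes
  have hspike : ∀ t : ℝ, ∃ c, (∀ a b, G.Adj a b → t ∈ Ioo (p a 0) (p b 0) →
      chord (p a) (p b) t < c) ∧ c < M₀ ∧
      ∀ u v, p u 0 < p v 0 → ¬ G.Adj u v → τ u v = t → c < chord (p u) (p v) t := by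
    intro t
    have hfin : ∀ (P : V → V → Prop), {y | ∃ u v, P u v ∧ chord (p u) (p v) t = y}.Finite := fun P =>
      (Set.finite_range fun z : V × V => chord (p z.1) (p z.2) t).subset <| by
        rintro _ ⟨u, v, -, rfl⟩
        exact ⟨(u, v), rfl⟩
    -- Several missing edges may be exposed at the same `t`; a single spike serves them all, ending
    -- above every edge and below each of these missing edges.
    obtain ⟨c, h1, h2⟩ := (hfin fun a b => G.Adj a b ∧ t ∈ Ioo (p a 0) (p b 0)).exists_between'
      ((hfin fun u v => p u 0 < p v 0 ∧ ¬ G.Adj u v ∧ τ u v = t).insert M₀) <| by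
        rintro _ ⟨a, b, ⟨hab, ht⟩, rfl⟩ _ (rfl | ⟨u, v, ⟨huv, hn, rfl⟩, rfl⟩)
        · exact chord_lt (ht.1.trans ht.2) (Ioo_subset_Icc_self ht) (hM₀ a) (hM₀ b)
        · exact (hτ u v huv hn).2.2 a b hab ht
    exact ⟨c, fun a b hab ht => h1 _ ⟨a, b, ⟨hab, ht⟩, rfl⟩, h2 _ (Set.mem_insert _ _),
      fun u v h h' h'' => h2 _ (Set.mem_insert_of_mem _ ⟨u, v, ⟨h, h', h''⟩, rfl⟩)⟩
  choose c hc₁ hc₂ hc₃ using hspike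
  set T : Finset ℝ := (Finset.univ.filter fun z : V × V => p z.1 0 < p z.2 0 ∧ ¬ G.Adj z.1 z.2).image
    fun z => τ z.1 z.2 with hT
  set X : Finset ℝ := Finset.univ.image fun v => p v 0 with hX
  have hXm : ∀ v, p v 0 ∈ X := fun v => Finset.mem_image_of_mem _ (Finset.mem_univ v)
  have hTm : ∀ u v, p u 0 < p v 0 → ¬ G.Adj u v → τ u v ∈ T := fun u v h1 h2 =>
    Finset.mem_image.2 ⟨(u, v), by simp [h1, h2], rfl⟩
  have hTX : ∀ t ∈ T, t ∉ X ∧ t ∈ Ioo (-(B + 1)) (B + 1) := by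
    intro t ht
    obtain ⟨⟨u, v⟩, hz, rfl⟩ := Finset.mem_image.1 ht
    simp only [Finset.mem_filter, Finset.mem_univ, true_and] at hz
    obtain ⟨h1, h2, -⟩ := hτ u v hz.1 hz.2
    refine ⟨fun h => ?_, (hB' u).1.trans h1.1, h1.2.trans (hB' v).2⟩
    obtain ⟨w, -, hw⟩ := Finset.mem_image.1 h
    exact h2 w hw
  have hXI : ∀ x ∈ X, x ∈ Ioo (-(B + 1)) (B + 1) := by
    intro x hx
    obtain ⟨v, -, rfl⟩ := Finset.mem_image.1 hx
    exact hB' v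
  obtain ⟨v₀⟩ := ‹Nonempty V›
  -- The lower boundary of the obstacle passes at height `M₀` over the vertices, dips to `c` at the
  -- exposed places, and reaches the top `M₀ + 1` only at the two ends.
  set val : ℝ → ℝ := fun x => if x ∈ Ioo (-(B + 1)) (B + 1) then if x ∈ X then M₀ else c x
    else M₀ + 1 with hval
  obtain ⟨f, n, m, hf, hfval, hn0, hnm, hnN, hcons⟩ :=
    exists_isComb (N := insert (-(B + 1))
    (insert (B + 1) (X ∪ T))) (val := val) (M := M₀ + 1) (L := -(B + 1)) (R := B + 1)
    (c := p v₀ 0) (by simp) (by simp) (by simp [hXm]) (hB' v₀)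
    (by
      have hLR : -(B + 1) ≤ B + 1 := ((hB' v₀).1.trans (hB' v₀).2).le
      intro x hx
      simp only [Finset.mem_insert, Finset.mem_union] at hx
      rcases hx with rfl | rfl | hx | hx
      · exact ⟨le_rfl, hLR⟩
      · exact ⟨hLR, le_rfl⟩
      · exact Ioo_subset_Icc_self (hXI x hx)
      · exact Ioo_subset_Icc_self (hTX x hx).2) (by simp [hval]) (by simp [hval])
    (by
      intro x _ hx
      simp only [hval, if_pos hx]
      split_ifs
      · linarith
      · linarith [hc₂ x])
  have hfX : ∀ v, f (p v 0) = M₀ := fun v => by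
    rw [hfval _ (by simp [hXm])]
    simp only [hval, if_pos (hB' v), if_pos (hXm v)]
  have hfT : ∀ t ∈ T, f t = c t := fun t ht => by
    rw [hfval _ (by simp [ht])]
    simp only [hval, if_pos (hTX t ht).2, if_neg (hTX t ht).1]
  have hfge : ∀ a b, G.Adj a b → p a 0 < p b 0 → ∀ x ∈ Icc (p a 0) (p b 0),
      chord (p a) (p b) x ≤ f x := by
    intro a b hab hlt x hx
    refine hf.chord_le (hn0 ▸ (hB' a).1.le) (hnm ▸ (hB' b).2.le) (fun i hi => hcons i hi _ ?_)
      (fun i hi => hcons i hi _ ?_) ?_ hx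
    · simp [hXm]
    · simp [hXm]
    · intro i hi hI
      have := hnN i hi
      simp only [Finset.mem_insert, Finset.mem_union] at this
      rcases this with h | h | h | h
      · exact absurd hI.1 (h ▸ (hB' a).1.not_ge)
      · exact absurd hI.2 (h ▸ (hB' b).2.not_ge)
      · obtain ⟨v, -, hv⟩ := Finset.mem_image.1 h
        rw [← hv, hfX]
        exact (chord_lt hlt (hv ▸ hI) (hM₀ a) (hM₀ b)).le
      · rw [hfT _ h]
        have hne : ∀ v, p v 0 ≠ n i := fun v hv => (hTX _ h).1 (hv ▸ hXm v)
        exact (hc₁ _ a b hab ⟨lt_of_le_of_ne hI.1 (hne a), lt_of_le_of_ne hI.2 (hne b).symm⟩).le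
  have hdraw : ∀ q ∈ straightLineDrawing G p, q 1 ≤ f (q 0) := by
    rintro q (⟨v, rfl⟩ | ⟨u, v, huv, hq⟩)
    · rw [hfX]; exact (hM₀ v).le
    · rcases (hx u v huv.ne).lt_or_gt with h | h
      · rw [mem_segment_iff_chord h] at hq
        rw [hq.2]; exact hfge u v huv h _ hq.1
      · rw [segment_symm, mem_segment_iff_chord h] at hq
        rw [hq.2]; exact hfge v u huv.symm h _ hq.1
  have hnon : ∀ u v, p u 0 < p v 0 → ¬ G.Adj u v →
      ¬ Disjoint (segment ℝ (p u) (p v)) (combRegion f (M₀ + 1)) := by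
    intro u v h hn
    obtain ⟨h1, h2, h3⟩ := hτ u v h hn
    refine Set.not_disjoint_iff.2 ⟨!₂[τ u v, chord (p u) (p v) (τ u v)],
      (mem_segment_iff_chord h _).2 ⟨Ioo_subset_Icc_self h1, by simp⟩, ?_, ?_⟩
    · simpa [hfT _ (hTm u v h hn)] using hc₃ _ u v h hn rfl
    · have := chord_lt h (Ioo_subset_Icc_self h1) (hM₀ u) (hM₀ v)
      simp; linarith
  refine ⟨p, combRegion f (M₀ + 1), ⟨hf.isOpenSimplePolygon, hp, ?_, ?_⟩,
    hf.combRegion_subset_unboundedComponent hdraw⟩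
  · intro v hv
    exact (hdraw _ (Or.inl ⟨v, rfl⟩)).not_gt hv.1
  · intro u v
    constructor
    · exact fun h => ⟨h.ne, Set.disjoint_left.2 fun q hq hqC =>
        (hdraw q (segment_subset_drawing h hq)).not_gt hqC.1⟩
    · rintro ⟨hne, hd⟩
      by_contra hn
      rcases (hx u v hne).lt_or_gt with h | h
      · exact hnon u v h hn hd
      · exact hnon v u h (fun h' => hn h'.symm) (by rwa [segment_symm])

/-! ### Exposed placements of forests -/

/-- A placement of the vertices in `S` where every vertex lies strictly above the edges below or
above it, and where every segment between two vertices lies strictly above all (other) edges at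
some place. -/
structure IsExposedPlacement {V : Type*} (G : SimpleGraph V) (p : V → Plane) (S : Finset V) : Prop where
  ne : ∀ u ∈ S, ∀ v ∈ S, u ≠ v → p u 0 ≠ p v 0
  cross_ne : ∀ u ∈ S, ∀ v ∈ S, ∀ w ∈ S, u ≠ v → u ≠ w → v ≠ w → cross (p u) (p v) (p w) ≠ 0
  vertex : ∀ v ∈ S, ∀ a ∈ S, ∀ b ∈ S, G.Adj a b → p v 0 ∈ Ioo (p a 0) (p b 0) →
    chord (p a) (p b) (p v 0) < p v 1
  -- Edges must be exposed too: a vertex `w` added next to `u` inherits the exposure of its segment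
  -- to `v` from that of `u v`, even if `u v` is an edge and the new segment is not.
  pair : ∀ u ∈ S, ∀ v ∈ S, p u 0 < p v 0 → ∃ t ∈ Ioo (p u 0) (p v 0), (∀ w ∈ S, p w 0 ≠ t) ∧
    ∀ a ∈ S, ∀ b ∈ S, G.Adj a b → t ∈ Ioo (p a 0) (p b 0) → (a, b) ≠ (u, v) →
      chord (p a) (p b) t < chord (p u) (p v) t

theorem chord_right {a b : Plane} (h : a 0 ≠ b 0) : chord a b (b 0) = b 1 := by
  have : b 0 - a 0 ≠ 0 := sub_ne_zero.2 h.symm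
  unfold chord; field_simp; ring

/-- Lets one small `ε` serve the whole stretch between `u` and the new point, not only its right
end. -/
theorem eventually_forall_Ioc {x : ℝ} {P : ℝ → Prop} (h : ∀ᶠ t in 𝓝[>] x, P t) :
    ∀ᶠ ε in 𝓝[>] (0 : ℝ), ∀ t ∈ Ioc x (x + ε), P t := by
  obtain ⟨y, hy, hP⟩ := (mem_nhdsGT_iff_exists_Ioo_subset).1 h
  have : Ioo 0 (y - x) ∈ 𝓝[>] (0 : ℝ) := Ioo_mem_nhdsGT (sub_pos.2 hy)
  filter_upwards [this] with ε hε t ht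
  exact hP ⟨ht.1, by linarith [ht.2, hε.2]⟩

namespace IsExposedPlacement

variable {V : Type*} {G : SimpleGraph V} {p : V → Plane} {S : Finset V}

/-- The conditions on a new point `q` close to the point of `u`. -/
theorem exists_point (h : IsExposedPlacement G p S) {u : V} (hu : u ∈ S) (τ : V → V → ℝ)
    (hτ : ∀ u ∈ S, ∀ v ∈ S, p u 0 < p v 0 → τ u v ∈ Ioo (p u 0) (p v 0) ∧
      (∀ w ∈ S, p w 0 ≠ τ u v) ∧
      ∀ a ∈ S, ∀ b ∈ S, G.Adj a b → τ u v ∈ Ioo (p a 0) (p b 0) → (a, b) ≠ (u, v) →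
        chord (p a) (p b) (τ u v) < chord (p u) (p v) (τ u v)) :
    ∃ q : Plane, p u 0 < q 0 ∧
      (∀ v ∈ S, p u 0 < p v 0 → q 0 < p v 0) ∧
      (∀ a ∈ S, ∀ b ∈ S, a ≠ b → cross q (p a) (p b) ≠ 0) ∧
      (∀ a ∈ S, ∀ b ∈ S, G.Adj a b → ∀ t ∈ Ioc (p u 0) (q 0), t ∈ Ioo (p a 0) (p b 0) →
        chord (p a) (p b) t < chord (p u) q t) ∧
      (∀ a ∈ S, ∀ b ∈ S, p a 0 < p b 0 → τ a b ∉ Ioc (p u 0) (q 0)) ∧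
      (∀ v ∈ S, p u 0 < p v 0 → ∀ a ∈ S, ∀ b ∈ S, G.Adj a b → τ u v ∈ Ioo (p a 0) (p b 0) →
        chord (p a) (p b) (τ u v) < chord q (p v) (τ u v)) ∧
      (∀ v ∈ S, p v 0 < p u 0 → ∀ a ∈ S, ∀ b ∈ S, G.Adj a b → τ v u ∈ Ioo (p a 0) (p b 0) →
        chord (p a) (p b) (τ v u) < chord (p v) q (τ v u)) := by
  -- a slope larger than all slopes at `u`
  obtain ⟨K, hK⟩ : ∃ K : ℝ, ∀ v ∈ S, (p v 1 - p u 1) / (p v 0 - p u 0) < K := by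
    obtain ⟨B, hB⟩ := (S.finite_toSet.image
      fun v => (p v 1 - p u 1) / (p v 0 - p u 0)).bddAbove
    exact ⟨B + 1, fun v hv => by linarith [hB ⟨v, hv, rfl⟩]⟩
  have hKr : ∀ v ∈ S, p u 0 < p v 0 → p v 1 - p u 1 < K * (p v 0 - p u 0) := fun v hv hlt =>
    (div_lt_iff₀ (sub_pos.2 hlt)).1 (hK v hv)
  have hKl : ∀ v ∈ S, p v 0 < p u 0 → p u 1 - p v 1 < K * (p u 0 - p v 0) := fun v hv hlt => by
    have := hK v hv
    rw [← neg_div_neg_eq, neg_sub, neg_sub, div_lt_iff₀ (sub_pos.2 hlt)] at this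
    exact this
  -- The new point moves on the ray of slope `K` to the right of `p u`. Near its start this ray is
  -- above the edges at `u` by the choice of `K`, and above the edges passing below `u` by
  -- continuity. Moving along it lifts the segments to all other vertices.
  set q : ℝ → Plane := fun ε => !₂[p u 0 + ε, p u 1 + K * ε] with hq
  have hq0 : ∀ ε, q ε 0 = p u 0 + ε := fun ε => by simp [hq]
  have hq1 : ∀ ε, q ε 1 = p u 1 + K * ε := fun ε => by simp [hq]
  have hqu : q 0 = p u := Plane.ext' (by simp [hq]) (by simp [hq])
  have hqc : Continuous q := (PiLp.continuous_toLp 2 _).comp (continuous_pi fun i => by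
    fin_cases i <;> simp <;> fun_prop)
  have hline : ∀ ε, 0 < ε → ∀ t, chord (p u) (q ε) t = p u 1 + K * (t - p u 0) := fun ε hε t => by
    simp only [chord, hq0, hq1, add_sub_cancel_left, mul_div_cancel_right₀ _ hε.ne']
  have e1 : ∀ᶠ t in 𝓝[>] (p u 0), (∀ v ∈ S, p u 0 < p v 0 → t < p v 0) ∧
      (∀ a ∈ S, ∀ b ∈ S, t ≠ τ a b) ∧
      (∀ a ∈ S, ∀ b ∈ S, G.Adj a b → t ∈ Ioo (p a 0) (p b 0) →
        chord (p a) (p b) t < p u 1 + K * (t - p u 0)) := by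
    refine (((eventually_all_finset S).2 fun v hv => ?_).and (((eventually_all_finset S).2
      fun a ha => (eventually_all_finset S).2 fun b hb => ?_).and ((eventually_all_finset S).2
      fun a ha => (eventually_all_finset S).2 fun b hb => ?_)))
    · by_cases hlt : p u 0 < p v 0
      · filter_upwards [Ioo_mem_nhdsGT hlt] with t ht _ using ht.2
      · exact Eventually.of_forall fun t h => absurd h hlt
    · rcases le_or_gt (τ a b) (p u 0) with hle | hlt
      · filter_upwards [self_mem_nhdsWithin] with t ht using (hle.trans_lt ht).ne'
      · filter_upwards [Ioo_mem_nhdsGT hlt] with t ht using ht.2.ne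
    · by_cases hau : a = u
      · subst hau
        filter_upwards [self_mem_nhdsWithin] with t ht hab hI
        have h1 := hK b hb
        have h2 : 0 < t - p a 0 := sub_pos.2 ht
        unfold chord
        nlinarith
      by_cases hbu : b = u
      · subst hbu
        filter_upwards [self_mem_nhdsWithin] with t ht hab hI
        exact absurd hI.2 (not_lt.2 (le_of_lt ht))
      rcases (h.ne a ha u hu hau).lt_or_gt with h1 | h1
      · rcases (h.ne b hb u hu hbu).lt_or_gt with h2 | h2
        · filter_upwards [self_mem_nhdsWithin] with t ht hab hI
          exact absurd (hI.2.trans h2) (not_lt.2 (le_of_lt ht))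
        · by_cases hab : G.Adj a b
          · have hc : ContinuousAt (fun t => chord (p a) (p b) t) (p u 0) := by
              unfold chord; fun_prop
            have hc' : ContinuousAt (fun t => p u 1 + K * (t - p u 0)) (p u 0) := by fun_prop
            have := hc.eventually_lt hc' (by simpa using h.vertex u hu a ha b hb hab ⟨h1, h2⟩)
            filter_upwards [mem_nhdsWithin_of_mem_nhds this] with t ht _ _ using ht
          · exact Eventually.of_forall fun t h => absurd h hab
      · filter_upwards [Ioo_mem_nhdsGT h1] with t ht _ hI
        exact absurd hI.1 ht.2.not_gt
  have e2 : ∀ᶠ ε in 𝓝[>] (0 : ℝ), ∀ a ∈ S, ∀ b ∈ S, a ≠ b → cross (q ε) (p a) (p b) ≠ 0 := by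
    refine (eventually_all_finset S).2 fun a ha => (eventually_all_finset S).2 fun b hb => ?_
    have hslope : ∀ v ∈ S, v ≠ u → p v 1 - p u 1 ≠ K * (p v 0 - p u 0) := fun v hv hvu => by
      rcases (h.ne v hv u hu hvu).lt_or_gt with h1 | h1
      · intro h2; linarith [hKl v hv h1]
      · exact (hKr v hv h1).ne
    by_cases hab : a = b
    · exact Eventually.of_forall fun _ h => absurd hab h
    by_cases hau : a = u
    · subst hau
      filter_upwards [self_mem_nhdsWithin] with ε hε _ h0
      refine hslope b hb (Ne.symm hab) ?_
      have : ε * (p b 1 - p a 1 - K * (p b 0 - p a 0)) = 0 := by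
        simp only [cross, hq0, hq1] at h0
        linear_combination -h0
      exact sub_eq_zero.1 ((mul_eq_zero.1 this).resolve_left (ne_of_gt hε))
    by_cases hbu : b = u
    · subst hbu
      filter_upwards [self_mem_nhdsWithin] with ε hε _ h0
      refine hslope a ha hab ?_
      have : ε * (p a 1 - p b 1 - K * (p a 0 - p b 0)) = 0 := by
        simp only [cross, hq0, hq1] at h0
        linear_combination h0
      exact sub_eq_zero.1 ((mul_eq_zero.1 this).resolve_left (ne_of_gt hε))
    have hc : Continuous fun ε => cross (q ε) (p a) (p b) := by unfold cross; fun_prop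
    have : cross (q 0) (p a) (p b) ≠ 0 := by
      rw [hqu]; exact h.cross_ne u hu a ha b hb (Ne.symm hau) (Ne.symm hbu) hab
    filter_upwards [mem_nhdsWithin_of_mem_nhds (hc.continuousAt.eventually_ne this)] with ε hε _
      using hε
  have hqε : ∀ i, Continuous fun ε => q ε i := fun i => by fun_prop
  have e3 : ∀ᶠ ε in 𝓝[>] (0 : ℝ), ∀ v ∈ S, p u 0 < p v 0 → ∀ a ∈ S, ∀ b ∈ S, G.Adj a b →
      τ u v ∈ Ioo (p a 0) (p b 0) → chord (p a) (p b) (τ u v) < chord (q ε) (p v) (τ u v) := by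
    refine (eventually_all_finset S).2 fun v hv => ?_
    by_cases hlt : p u 0 < p v 0
    swap
    · exact Eventually.of_forall fun _ h => absurd h hlt
    obtain ⟨hI, -, hex⟩ := hτ u hu v hv hlt
    have hup : ∀ᶠ ε in 𝓝[>] (0 : ℝ), chord (p u) (p v) (τ u v) < chord (q ε) (p v) (τ u v) := by
      filter_upwards [Ioo_mem_nhdsGT (sub_pos.2 hlt)] with ε hε
      have hD : 0 < p v 0 - p u 0 := sub_pos.2 hlt
      have hDε : 0 < p v 0 - (p u 0 + ε) := by linarith [hε.2]
      have hK' := hKr v hv hlt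
      have h1 : chord (p u) (p v) (τ u v) =
          p v 1 - (p v 1 - p u 1) / (p v 0 - p u 0) * (p v 0 - τ u v) := by
        unfold chord; field_simp; ring
      have h2 : chord (q ε) (p v) (τ u v) = p v 1 -
          (p v 1 - (p u 1 + K * ε)) / (p v 0 - (p u 0 + ε)) * (p v 0 - τ u v) := by
        simp only [chord, hq0, hq1]; field_simp; ring
      rw [h1, h2]
      have : (p v 1 - (p u 1 + K * ε)) / (p v 0 - (p u 0 + ε)) <
          (p v 1 - p u 1) / (p v 0 - p u 0) := by
        rw [div_lt_div_iff₀ hDε hD]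
        nlinarith [mul_lt_mul_of_pos_left hK' hε.1]
      have h3 : 0 < p v 0 - τ u v := sub_pos.2 hI.2
      nlinarith
    filter_upwards [hup] with ε hε _ a ha b hb hab hI'
    by_cases hne : (a, b) = (u, v)
    · obtain ⟨rfl, rfl⟩ := Prod.mk.inj hne
      exact hε
    · exact (hex a ha b hb hab hI' hne).trans hε
  have e4 : ∀ᶠ ε in 𝓝[>] (0 : ℝ), ∀ v ∈ S, p v 0 < p u 0 → ∀ a ∈ S, ∀ b ∈ S, G.Adj a b →
      τ v u ∈ Ioo (p a 0) (p b 0) → chord (p a) (p b) (τ v u) < chord (p v) (q ε) (τ v u) := by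
    refine (eventually_all_finset S).2 fun v hv => ?_
    by_cases hlt : p v 0 < p u 0
    swap
    · exact Eventually.of_forall fun _ h => absurd h hlt
    obtain ⟨hI, -, hex⟩ := hτ v hv u hu hlt
    filter_upwards [self_mem_nhdsWithin] with ε hε _ a ha b hb hab hI'
    have hε' : 0 < ε := hε
    have hup : chord (p v) (p u) (τ v u) < chord (p v) (q ε) (τ v u) := by
      have hD : 0 < p u 0 - p v 0 := sub_pos.2 hlt
      have hDε : 0 < p u 0 + ε - p v 0 := by linarith
      have hK' := hKl v hv hlt
      simp only [chord, hq0, hq1]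
      have : (p u 1 - p v 1) / (p u 0 - p v 0) <
          (p u 1 + K * ε - p v 1) / (p u 0 + ε - p v 0) := by
        rw [div_lt_div_iff₀ hD hDε]
        nlinarith [mul_lt_mul_of_pos_left hK' hε']
      have h3 : 0 < τ v u - p v 0 := sub_pos.2 hI.1
      nlinarith
    by_cases hne : (a, b) = (v, u)
    · obtain ⟨rfl, rfl⟩ := Prod.mk.inj hne
      exact hup
    · exact (hex a ha b hb hab hI' hne).trans hup
  obtain ⟨ε, ⟨⟨⟨h1, h2⟩, h3⟩, h4⟩, hε⟩ :=
    ((((eventually_forall_Ioc e1).and e2).and e3).and e4 |>.and self_mem_nhdsWithin).exists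
  have hε' : 0 < ε := hε
  refine ⟨q ε, by rw [hq0]; linarith, ?_, h2, ?_, ?_, h3, h4⟩
  · intro v hv hlt
    rw [hq0]
    exact (h1 _ ⟨by linarith, le_rfl⟩).1 v hv hlt
  · intro a ha b hb hab t ht hI
    rw [hq0] at ht
    rw [hline ε hε']
    exact (h1 t ht).2.2 a ha b hb hab hI
  · intro a ha b hb _ hI
    rw [hq0] at hI
    exact (h1 _ hI).2.1 a ha b hb rfl

end IsExposedPlacement

namespace IsExposedPlacement

variable {V : Type*} {G : SimpleGraph V} {p : V → Plane} {S : Finset V}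

/-- A vertex with at most one neighbour can be added to a placement. -/
theorem exists_insert [DecidableEq V] (h : IsExposedPlacement G p S) {u w : V} (hu : u ∈ S)
    (hw : w ∉ S) (hadj : ∀ x ∈ S, G.Adj w x → x = u) :
    ∃ p' : V → Plane, IsExposedPlacement G p' (insert w S) := by
  have hpair := h.pair
  choose! τ hτ using hpair
  obtain ⟨q, q0, q1, q2, q3, q4, q5, q6⟩ := h.exists_point hu τ hτ
  set p' : V → Plane := Function.update p w q with hp'
  have pw : p' w = q := by simp [hp']
  have ps : ∀ v ∈ S, p' v = p v := fun v hv =>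
    Function.update_of_ne (ne_of_mem_of_not_mem hv hw) _ _
  have qne : ∀ v ∈ S, q 0 ≠ p v 0 := fun v hv => by
    by_cases hvu : v = u
    · subst hvu; exact q0.ne'
    · rcases (h.ne v hv u hu hvu).lt_or_gt with h1 | h1
      · exact (h1.trans q0).ne'
      · exact (q1 v hv h1).ne
  have left : ∀ v ∈ S, v ≠ u → p v 0 < q 0 → p v 0 < p u 0 := fun v hv hvu hlt =>
    (h.ne v hv u hu hvu).lt_or_gt.resolve_right fun h1 => (q1 v hv h1).not_gt hlt
  have right : ∀ v ∈ S, q 0 < p v 0 → p u 0 < p v 0 := fun v _ hlt => q0.trans hlt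
  -- the only edge at `w` is the one to `u`
  have hno : ∀ t, t ∉ Ioo (p u 0) (q 0) → ∀ a ∈ insert w S, ∀ b ∈ insert w S, G.Adj a b →
      t ∈ Ioo (p' a 0) (p' b 0) → a ∈ S ∧ b ∈ S := by
    intro t ht a ha b hb hab hI
    rcases Finset.mem_insert.1 ha with rfl | ha' <;> rcases Finset.mem_insert.1 hb with rfl | hb'
    · exact absurd rfl hab.ne
    · obtain rfl := hadj b hb' hab
      rw [pw, ps b hb'] at hI
      exact absurd (hI.1.trans hI.2) q0.not_gt
    · obtain rfl := hadj a ha' hab.symm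
      rw [pw, ps a ha'] at hI
      exact absurd hI ht
    · exact ⟨ha', hb'⟩
  refine ⟨p', ?_, ?_, ?_, ?_⟩
  · intro x hx y hy hxy
    rcases Finset.mem_insert.1 hx with rfl | hx' <;> rcases Finset.mem_insert.1 hy with rfl | hy'
    · exact absurd rfl hxy
    · rw [pw, ps y hy']; exact qne y hy'
    · rw [pw, ps x hx']; exact (qne x hx').symm
    · rw [ps x hx', ps y hy']; exact h.ne x hx' y hy' hxy
  · intro x hx y hy z hz hxy hxz hyz
    rcases Finset.mem_insert.1 hx with rfl | hx' <;> rcases Finset.mem_insert.1 hy with rfl | hy' <;>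
      rcases Finset.mem_insert.1 hz with rfl | hz'
    any_goals exact absurd rfl ‹_›
    · rw [pw, ps y hy', ps z hz']; exact q2 y hy' z hz' hyz
    · rw [pw, ps x hx', ps z hz', ← cross_rotate]; exact q2 z hz' x hx' hxz.symm
    · rw [pw, ps x hx', ps y hy', cross_rotate]; exact q2 x hx' y hy' hxy
    · rw [ps x hx', ps y hy', ps z hz']; exact h.cross_ne x hx' y hy' z hz' hxy hxz hyz
  · intro v hv a ha b hb hab hI
    have hvI : p' v 0 ∉ Ioo (p u 0) (q 0) := by
      rcases Finset.mem_insert.1 hv with rfl | hv'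
      · rw [pw]; exact fun hh => lt_irrefl _ hh.2
      · rw [ps v hv']; exact fun hh => (q1 v hv' hh.1).not_gt hh.2
    obtain ⟨ha', hb'⟩ := hno _ hvI a ha b hb hab hI
    rw [ps a ha', ps b hb'] at hI ⊢
    rcases Finset.mem_insert.1 hv with rfl | hv'
    · rw [pw] at hI ⊢
      have := q3 a ha' b hb' hab (q 0) ⟨q0, le_rfl⟩ hI
      rwa [chord_right q0.ne] at this
    · rw [ps v hv'] at hI ⊢
      exact h.vertex v hv' a ha' b hb' hab hI
  · intro x hx y hy hlt
    rcases Finset.mem_insert.1 hx with rfl | hx' <;> rcases Finset.mem_insert.1 hy with rfl | hy'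
    · exact absurd hlt (lt_irrefl _)
    · rw [pw, ps y hy'] at hlt ⊢
      have hlt' := right y hy' hlt
      -- The place exposed for `u y` is reused: over it the segment from `w` runs above the one from
      -- `u`, and the edge between `u` and `w` is too short to reach it.
      obtain ⟨hI, hne, -⟩ := hτ u hu y hy' hlt'
      have ht : τ u y ∉ Ioc (p u 0) (q 0) := q4 u hu y hy' hlt'
      have hqτ : q 0 < τ u y := not_le.1 fun hh => ht ⟨hI.1, hh⟩
      refine ⟨τ u y, ⟨hqτ, hI.2⟩, ?_, ?_⟩
      · intro z hz
        rcases Finset.mem_insert.1 hz with rfl | hz'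
        · rw [pw]; exact hqτ.ne
        · rw [ps z hz']; exact hne z hz'
      · intro a ha b hb hab hJ _
        obtain ⟨ha', hb'⟩ := hno _ (fun hh => ht (Ioo_subset_Ioc_self hh)) a ha b hb hab hJ
        rw [ps a ha', ps b hb'] at hJ ⊢
        exact q5 y hy' hlt' a ha' b hb' hab hJ
    · rw [pw, ps x hx'] at hlt ⊢
      by_cases hxu : x = u
      · subst hxu
        -- The pair `u w` has no old place to inherit; any place between the two will do, as the
        -- whole short segment is above the old edges.
        obtain ⟨t, ht1, ht2⟩ := exists_between q0
        refine ⟨t, ⟨ht1, ht2⟩, ?_, ?_⟩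
        · intro z hz
          rcases Finset.mem_insert.1 hz with rfl | hz'
          · rw [pw]; exact ht2.ne'
          · rw [ps z hz']
            rintro rfl
            exact (q1 z hz' ht1).not_gt ht2
        · intro a ha b hb hab hJ hne
          rcases Finset.mem_insert.1 ha with rfl | ha' <;> rcases Finset.mem_insert.1 hb with rfl | hb'
          · exact absurd rfl hab.ne
          · obtain rfl := hadj b hb' hab
            rw [pw, ps b hb'] at hJ
            exact absurd (hJ.1.trans hJ.2) q0.not_gt
          · obtain rfl := hadj a ha' hab.symm
            exact absurd rfl hne
          · rw [ps a ha', ps b hb'] at hJ ⊢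
            exact q3 a ha' b hb' hab t ⟨ht1, ht2.le⟩ hJ
      · have hlt' := left x hx' hxu hlt
        obtain ⟨hI, hne, -⟩ := hτ x hx' u hu hlt'
        refine ⟨τ x u, ⟨hI.1, hI.2.trans q0⟩, ?_, ?_⟩
        · intro z hz
          rcases Finset.mem_insert.1 hz with rfl | hz'
          · rw [pw]; exact (hI.2.trans q0).ne'
          · rw [ps z hz']; exact hne z hz'
        · intro a ha b hb hab hJ _
          obtain ⟨ha', hb'⟩ := hno _ (fun hh => hh.1.not_gt hI.2) a ha b hb hab hJ
          rw [ps a ha', ps b hb'] at hJ ⊢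
          exact q6 x hx' hlt' a ha' b hb' hab hJ
    · rw [ps x hx', ps y hy'] at hlt ⊢
      obtain ⟨hI, hne, hex⟩ := hτ x hx' y hy' hlt
      have ht := q4 x hx' y hy' hlt
      refine ⟨τ x y, hI, ?_, ?_⟩
      · intro z hz
        rcases Finset.mem_insert.1 hz with rfl | hz'
        · rw [pw]
          rintro hh
          exact ht ⟨hh ▸ q0, hh.ge⟩
        · rw [ps z hz']; exact hne z hz'
      · intro a ha b hb hab hJ hne'
        obtain ⟨ha', hb'⟩ := hno _ (fun hh => ht (Ioo_subset_Ioc_self hh)) a ha b hb hab hJ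
        rw [ps a ha', ps b hb'] at hJ ⊢
        exact hex a ha' b hb' hab hJ hne'

end IsExposedPlacement

/-- A nonempty finite set of vertices of an acyclic graph contains a vertex with at most one
neighbour in the set. -/
theorem SimpleGraph.IsAcyclic.exists_neighbors_subsingleton {V : Type*} {G : SimpleGraph V}
    (hG : G.IsAcyclic) {S : Finset V} (hS : S.Nonempty) :
    ∃ w ∈ S, ∀ x ∈ S, ∀ y ∈ S, G.Adj w x → G.Adj w y → x = y := by
  classical
  have : Nonempty S := hS.to_subtype
  -- The induced forest is extended to a spanning tree of the complete graph on `S`; a leaf of the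
  -- tree has at most one neighbour in the forest.
  obtain ⟨T, hT, -, hTt⟩ := (SimpleGraph.connected_top (V := S)).exists_isTree_le_of_le_of_isAcyclic
    le_top (hG.comap (G' := G) (SimpleGraph.Hom.comap Subtype.val G) Subtype.val_injective)
  rcases subsingleton_or_nontrivial S with hs | hs
  · obtain ⟨w, hw⟩ := hS
    exact ⟨w, hw, fun x hx y hy _ _ => congrArg Subtype.val (Subsingleton.elim (⟨x, hx⟩ : S) ⟨y, hy⟩)⟩
  · obtain ⟨w, hw⟩ := hTt.exists_vert_degree_one_of_nontrivial
    obtain ⟨u, -, hu⟩ := SimpleGraph.degree_eq_one_iff_existsUnique_adj.1 hw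
    exact ⟨w, w.2, fun x hx y hy hwx hwy => congrArg Subtype.val
      ((hu ⟨x, hx⟩ (hT hwx)).trans (hu ⟨y, hy⟩ (hT hwy)).symm)⟩

/-- Induction on the size of `S`: remove a vertex with at most one neighbour in `S` and put it back
close to that neighbour. -/
theorem SimpleGraph.IsAcyclic.exists_isExposedPlacement {V : Type*} {G : SimpleGraph V}
    (hG : G.IsAcyclic) (S : Finset V) : ∃ p : V → Plane, IsExposedPlacement G p S := by
  classical
  induction hn : S.card generalizing S with
  | zero =>
    obtain rfl := Finset.card_eq_zero.1 hn
    exact ⟨fun _ => 0, by simp, by simp, by simp, by simp⟩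
  | succ n ih =>
    obtain ⟨w, hw, huniq⟩ := hG.exists_neighbors_subsingleton
      (Finset.card_pos.1 (by rw [hn]; exact n.succ_pos))
    obtain ⟨p, hp⟩ := ih (S.erase w) (by rw [Finset.card_erase_of_mem hw, hn]; rfl)
    rw [← Finset.insert_erase hw]
    rcases (S.erase w).eq_empty_or_nonempty with he | ⟨u, hu⟩
    · rw [he]
      refine ⟨p, ?_, ?_, ?_, ?_⟩
      · intro u hu v hv; simp_all
      · intro u hu v hv; simp_all
      · intro v hv a ha b hb hab
        rw [Finset.mem_insert, or_iff_left (Finset.notMem_empty _)] at ha hb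
        exact absurd (ha.trans hb.symm) hab.ne
      · intro u hu v hv; simp_all
    · by_cases hex : ∃ x ∈ S.erase w, G.Adj w x
      · obtain ⟨x, hx, hwx⟩ := hex
        exact hp.exists_insert hx (Finset.notMem_erase _ _) fun y hy hwy =>
          huniq y (Finset.mem_of_mem_erase hy) x (Finset.mem_of_mem_erase hx) hwy hwx
      -- A vertex isolated within `S` may be placed next to any other vertex.
      · exact hp.exists_insert hu (Finset.notMem_erase _ _) fun y hy hwy => absurd ⟨y, hy, hwy⟩ hex

theorem SimpleGraph.IsAcyclic.hasOutsideObstacleRepresentation {V : Type*} [Finite V] [Nonempty V]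
    {G : SimpleGraph V} (hG : G.IsAcyclic) : HasOutsideObstacleRepresentation G := by
  classical
  have := Fintype.ofFinite V
  obtain ⟨p, hp⟩ := hG.exists_isExposedPlacement Finset.univ
  have hne : ∀ u v, u ≠ v → p u 0 ≠ p v 0 := fun u v huv =>
    hp.ne u (Finset.mem_univ u) v (Finset.mem_univ v) huv
  refine hasOutsideObstacleRepresentation_of_exposed (p := p)
    (inGeneralPosition_iff.2 ⟨fun u v huv => ?_, ?_⟩) hne ?_
  · by_contra hh
    exact hne u v hh (by rw [huv])
  · intro u v w
    exact hp.cross_ne u (Finset.mem_univ u) v (Finset.mem_univ v) w (Finset.mem_univ w)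
  · intro u v huv hn
    obtain ⟨t, ht, h1, h2⟩ := hp.pair u (Finset.mem_univ u) v (Finset.mem_univ v) huv
    refine ⟨t, ht, fun w => h1 w (Finset.mem_univ w), fun a b hab hI =>
      h2 a (Finset.mem_univ a) b (Finset.mem_univ b) hab hI fun e => ?_⟩
    obtain ⟨rfl, rfl⟩ := Prod.mk.inj e
    exact hn hab

/-! ### An outside obstacle for `K_{2,3}` -/

/-- The point with the given integer coordinates. -/
noncomputable def latticePoint (a : ℤ × ℤ) : Plane := !₂[(a.1 : ℝ), (a.2 : ℝ)]

theorem latticePoint_zero (a : ℤ × ℤ) : latticePoint a 0 = a.1 := by simp [latticePoint]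

theorem latticePoint_one (a : ℤ × ℤ) : latticePoint a 1 = a.2 := by simp [latticePoint]

theorem cross_latticePoint (a b c : ℤ × ℤ) : cross (latticePoint a) (latticePoint b)
    (latticePoint c) =
      (((b.1 - a.1) * (c.2 - a.2) - (b.2 - a.2) * (c.1 - a.1) : ℤ) : ℝ) := by
  simp only [cross, latticePoint_zero, latticePoint_one]; push_cast; rfl

theorem completeBipartiteGraph_two_three_hasOutsideObstacleRepresentation :
    HasOutsideObstacleRepresentation (completeBipartiteGraph (Fin 2) (Fin 3)) := by
  -- The side of size three is placed to the left of the side of size two, so each edge runs from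
  -- `inr` to `inl` and only four missing edges remain to be exposed.
  set P : Fin 2 ⊕ Fin 3 → ℤ × ℤ := Sum.elim ![(5, 1), (4, 6)] ![(3, 6), (0, 1), (1, 5)] with hP
  have hne : ∀ u v, u ≠ v → latticePoint (P u) 0 ≠ latticePoint (P v) 0 := by
    simp only [latticePoint_zero, ne_eq, Int.cast_inj]
    decide
  refine hasOutsideObstacleRepresentation_of_exposed (p := fun v => latticePoint (P v))
    (inGeneralPosition_iff.2 ⟨fun u v huv => by_contra fun hh => hne u v hh
      (congrArg (fun q : Plane => q 0) huv), ?_⟩) hne ?_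
  · simp only [cross_latticePoint, ne_eq, Int.cast_eq_zero]
    decide
  · -- the edges, from left to right, and the places where the other segments are exposed
    have hadj : ∀ a b, (completeBipartiteGraph (Fin 2) (Fin 3)).Adj a b →
        latticePoint (P a) 0 < latticePoint (P b) 0 →
        ∃ i j, a = .inr i ∧ b = .inl j := by
      simp only [completeBipartiteGraph_adj, latticePoint_zero, Int.cast_lt]
      decide
    have key : ∀ u v t, t ∈ Ioo (latticePoint (P u) 0) (latticePoint (P v) 0) →
        (∀ w, latticePoint (P w) 0 ≠ t) →
        (∀ i j, t ∈ Ioo (latticePoint (P (.inr i)) 0) (latticePoint (P (.inl j)) 0) →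
          chord (latticePoint (P (.inr i))) (latticePoint (P (.inl j))) t <
            chord (latticePoint (P u)) (latticePoint (P v)) t) →
        ∃ t ∈ Ioo (latticePoint (P u) 0) (latticePoint (P v) 0),
          (∀ w, latticePoint (P w) 0 ≠ t) ∧
          ∀ a b, (completeBipartiteGraph (Fin 2) (Fin 3)).Adj a b →
            t ∈ Ioo (latticePoint (P a) 0) (latticePoint (P b) 0) →
            chord (latticePoint (P a)) (latticePoint (P b)) t <
              chord (latticePoint (P u)) (latticePoint (P v)) t := by
      intro u v t h1 h2 h3
      refine ⟨t, h1, h2, fun a b hab ht => ?_⟩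
      obtain ⟨i, j, rfl, rfl⟩ := hadj a b hab (ht.1.trans ht.2)
      exact h3 i j ht
    have hnon : ∀ u v, latticePoint (P u) 0 < latticePoint (P v) 0 →
        ¬ (completeBipartiteGraph (Fin 2) (Fin 3)).Adj u v →
        (u = .inl 1 ∧ v = .inl 0) ∨ (u = .inr 1 ∧ v = .inr 0) ∨ (u = .inr 1 ∧ v = .inr 2) ∨
          (u = .inr 2 ∧ v = .inr 0) := by
      simp only [completeBipartiteGraph_adj, latticePoint_zero, Int.cast_lt]
      decide
    have h2 : (![(3, 6), (0, 1), (1, 5)] : Fin 3 → ℤ × ℤ) 2 = (1, 5) := rfl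
    intro u v huv hn
    rcases hnon u v huv hn with ⟨rfl, rfl⟩ | ⟨rfl, rfl⟩ | ⟨rfl, rfl⟩ | ⟨rfl, rfl⟩
    · apply key _ _ (17 / 4) <;> simp only [latticePoint_zero, latticePoint_one, chord]
      · norm_num [hP, h2]
      · rintro (i | i) <;> fin_cases i <;> norm_num [hP, h2]
      · intro i j; fin_cases i <;> fin_cases j <;> norm_num [hP, h2]
    -- Over `1 / 4` the only edges are the two at the leftmost point, and both missing edges from
    -- that point are steeper; this place is used for both of them.
    · apply key _ _ (1 / 4) <;> simp only [latticePoint_zero, latticePoint_one, chord]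
      · norm_num [hP, h2]
      · rintro (i | i) <;> fin_cases i <;> norm_num [hP, h2]
      · intro i j; fin_cases i <;> fin_cases j <;> norm_num [hP, h2]
    · apply key _ _ (1 / 4) <;> simp only [latticePoint_zero, latticePoint_one, chord]
      · norm_num [hP, h2]
      · rintro (i | i) <;> fin_cases i <;> norm_num [hP, h2]
      · intro i j; fin_cases i <;> fin_cases j <;> norm_num [hP, h2]
    · apply key _ _ (3 / 2) <;> simp only [latticePoint_zero, latticePoint_one, chord]
      · norm_num [hP, h2]
      · rintro (i | i) <;> fin_cases i <;> norm_num [hP, h2]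
      · intro i j; fin_cases i <;> fin_cases j <;> norm_num [hP, h2]

/-! ### `B₁₁` has no outside obstacle -/

/-- If `a` and `c` were on opposite sides, the closed walk `a b c d` would enclose the segment `b d`
and force it to be an edge. General position excludes the value zero. -/
theorem common_neighbors_same_side {V : Type*} {G : SimpleGraph V} {p : V → Plane}
    {C : Set Plane} (hrep : IsObstacleRepresentation G p C)
    (hC : C ⊆ unboundedComponent (straightLineDrawing G p)) {a b c d : V} (hbd : b ≠ d)
    (hn : ¬ G.Adj b d) (hab : G.Adj a b) (had : G.Adj a d) (hcb : G.Adj c b) (hcd : G.Adj c d) :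
    0 < cross (p b) (p d) (p a) * cross (p b) (p d) (p c) := by
  have gp := (inGeneralPosition_iff.1 hrep.2.1).2
  have ha := gp b d a hbd hab.ne' had.ne'
  have hc := gp b d c hbd hcb.ne' hcd.ne'
  have e : ∀ x : V, cross (p b) (p x) (p d) = -cross (p b) (p d) (p x) := fun x =>
    cross_swap' _ _ _
  rcases ha.lt_or_gt with ha | ha <;> rcases hc.lt_or_gt with hc | hc
  · exact mul_pos_of_neg_of_neg ha hc
  · exact absurd (adj_of_common_neighbors_opposite hrep hC hbd hcb hcd hab had
      (by rwa [← cross_rotate]) (by rw [e]; linarith)) hn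
  · exact absurd (adj_of_common_neighbors_opposite hrep hC hbd hab had hcb hcd
      (by rwa [← cross_rotate]) (by rw [e]; linarith)) hn
  · exact mul_pos ha hc

/-- There are no three disjoint sides `z i w i` of a convex hexagon and a point `v` such that, as
seen from `v`, each `w i` precedes both `z j` with `j ≠ i`. The sign conditions are stated for an
arbitrary antisymmetric bracket satisfying the Grassmann–Plücker relation. -/
theorem no_three_blocks {X : Type*} {D : X → X → X → ℝ}
    (hrot : ∀ a b c, D b c a = D a b c) (hswap : ∀ a b c, D b a c = -D a b c)
    (hplk : ∀ a b c d e, D a b c * D a d e - D a b d * D a c e + D a b e * D a c d = 0)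
    {v w₁ w₂ w₃ z₁ z₂ z₃ : X}
    (o₁₂ : 0 < D v w₁ w₂) (o₂₃ : 0 < D v w₂ w₃) (o₁₃ : 0 < D v w₁ w₃)
    (h₁₂ : 0 < D v w₁ z₂) (h₂₁ : 0 < D v w₂ z₁)
    (h₃₁ : 0 < D v w₃ z₁) (h₃₂ : 0 < D v w₃ z₂)
    (s₁ : 0 < D z₁ w₁ w₂ * D z₁ w₁ w₃)
    (s₂ : 0 < D z₂ w₂ w₁ * D z₂ w₂ w₃) (s₂' : 0 < D z₂ w₂ w₁ * D z₂ w₂ z₁)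
    (s₃ : 0 < D z₃ w₃ w₁ * D z₃ w₃ w₂) (s₃' : 0 < D z₃ w₃ w₁ * D z₃ w₃ z₁)
    (s₃'' : 0 < D z₃ w₃ w₁ * D z₃ w₃ z₂) : False := by
  -- This sign is not among the hypotheses; it follows since, seen from `v`, `w₂` precedes `w₃` and
  -- `w₃` precedes `z₂`.
  have h₂₂ : 0 < D v w₂ z₂ := by
    have := hplk v w₁ w₂ w₃ z₂
    have : 0 < D v w₁ w₃ * D v w₂ z₂ := by nlinarith [mul_pos o₁₂ h₃₂, mul_pos h₁₂ o₂₃]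
    exact pos_of_mul_pos_right this o₁₃.le
  have p1 : D v w₁ w₂ * D w₂ z₁ z₂ - D v w₂ z₁ * D w₁ w₂ z₂ + D v w₂ z₂ * D w₁ w₂ z₁ = 0 := by
    have := hplk w₂ v w₁ z₁ z₂
    rw [← hrot w₂ v w₁, hswap v w₂, hswap w₁ w₂, hswap v w₂, hswap w₁ w₂] at this
    linarith
  have p2 : D v w₁ w₃ * D w₃ z₁ z₃ - D v w₃ z₁ * D w₁ w₃ z₃ + D v w₃ z₃ * D w₁ w₃ z₁ = 0 := by
    have := hplk w₃ v w₁ z₁ z₃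
    rw [← hrot w₃ v w₁, hswap v w₃, hswap w₁ w₃, hswap v w₃, hswap w₁ w₃] at this
    linarith
  have p3 : D v w₂ w₃ * D w₃ z₂ z₃ - D v w₃ z₂ * D w₂ w₃ z₃ + D v w₃ z₃ * D w₂ w₃ z₂ = 0 := by
    have := hplk w₃ v w₂ z₂ z₃
    rw [← hrot w₃ v w₂, hswap v w₃, hswap w₂ w₃, hswap v w₃, hswap w₂ w₃] at this
    linarith
  rw [← hrot z₁ w₁, ← hrot z₁ w₁] at s₁
  rw [← hrot z₂ w₂ w₁, ← hrot z₂ w₂, hswap w₁ w₂] at s₂ s₂'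
  rw [← hrot z₃ w₃ w₁, ← hrot z₃ w₃, hswap w₁ w₃] at s₃ s₃' s₃''
  rw [hswap w₂ w₃] at s₃
  generalize D w₂ z₁ z₂ = c, D w₁ w₂ z₂ = a, D w₁ w₂ z₁ = e, D w₃ z₁ z₃ = k, D w₁ w₃ z₃ = l,
    D v w₃ z₃ = h, D w₁ w₃ z₁ = f, D w₃ z₂ z₃ = n, D w₂ w₃ z₃ = m, D w₂ w₃ z₂ = b at *
  -- in each case all three summands of `p3` have the same sign
  have main : ∀ {x y z : ℝ}, 0 < x → 0 < y → x * z = y → 0 < z := fun hx hy h =>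
    pos_of_mul_pos_right (h ▸ hy) hx.le
  have sgn : ∀ {x y : ℝ}, 0 < x * y → (0 < x ∧ 0 < y) ∨ (x < 0 ∧ y < 0) := fun h =>
    mul_pos_iff.1 h
  -- The brackets at `v` have known sign except `h`. Of the others only products have known sign, so
  -- each relation is multiplied by one of its own brackets: the resulting squares replace a case
  -- distinction.
  have he : 0 < a * e := main h₂₂ (y := D v w₂ z₁ * a ^ 2 + D v w₁ w₂ * (-a * c))
    (by nlinarith [mul_pos o₁₂ s₂', mul_nonneg h₂₁.le (sq_nonneg a)]) (by linear_combination a * p1)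
  have haf : 0 < a * f := by
    have : 0 < e ^ 2 * (a * f) := by nlinarith [mul_pos he s₁]
    exact pos_of_mul_pos_right this (sq_nonneg e)
  have hfh : 0 < l * (h * f) := by
    have : l * (h * f) = D v w₃ z₁ * l ^ 2 + D v w₁ w₃ * (-l * k) := by linear_combination l * p2
    rw [this]
    nlinarith [mul_pos o₁₃ s₃', mul_nonneg h₃₁.le (sq_nonneg l)]
  have hbf : 0 < -(b * f) := by
    have : 0 < a ^ 2 * -(b * f) := by nlinarith [mul_pos haf s₂]
    exact pos_of_mul_pos_right this (sq_nonneg a)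
  have hlhb : 0 < -(l * (h * b)) := by
    have : 0 < f ^ 2 * -(l * (h * b)) := by nlinarith [mul_pos hfh hbf]
    exact pos_of_mul_pos_right this (sq_nonneg f)
  nlinarith [mul_pos o₂₃ s₃'', mul_pos h₃₂ s₃, congrArg (l * ·) p3]

/-- Since `u` is on the positive side of every ray from `v` to `w i`, these rays lie in a
half-plane, and the Plücker relation makes their order around `v` transitive. It remains to sort
three of them. Abstracting the bracket allows for both orientations. -/
theorem no_three_blocks_of_common_upper {X : Type*} {D : X → X → X → ℝ}
    (hrot : ∀ a b c, D b c a = D a b c) (hswap : ∀ a b c, D b a c = -D a b c)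
    (hplk : ∀ a b c d e, D a b c * D a d e - D a b d * D a c e + D a b e * D a c d = 0)
    {ι : Type*} {v : X} {z w : ι → X} {u : X} {I : Set ι} {i j k : ι}
    (hi : i ∈ I) (hj : j ∈ I) (hk : k ∈ I) (hij : i ≠ j) (hik : i ≠ k) (hjk : j ≠ k)
    (hu : ∀ i ∈ I, 0 < D v (w i) u)
    (hne : ∀ i ∈ I, ∀ j ∈ I, i ≠ j → D v (w i) (w j) ≠ 0)
    (hz : ∀ i ∈ I, ∀ j ∈ I, i ≠ j → 0 < D v (w i) (z j))
    (hs : ∀ i j k, i ≠ j → i ≠ k → ∀ x ∈ ({z j, w j} : Set X), ∀ y ∈ ({z k, w k} : Set X),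
      0 < D (z i) (w i) x * D (z i) (w i) y) : False := by
  have sorted : ∀ i ∈ I, ∀ j ∈ I, ∀ k ∈ I, i ≠ j → i ≠ k → j ≠ k → 0 < D v (w i) (w j) →
      0 < D v (w j) (w k) → 0 < D v (w i) (w k) → False :=
    fun i hi j hj k hk hij hik hjk o₁ o₂ o₃ =>
      no_three_blocks hrot hswap hplk o₁ o₂ o₃ (hz i hi j hj hij)
        (hz j hj i hi hij.symm) (hz k hk i hi hik.symm) (hz k hk j hj hjk.symm)
        (hs i j k hij hik _ (by simp) _ (by simp))
        (hs j i k hij.symm hjk _ (by simp) _ (by simp))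
        (hs j i i hij.symm hij.symm _ (by simp) _ (by simp))
        (hs k i j hik.symm hjk.symm _ (by simp) _ (by simp))
        (hs k i i hik.symm hik.symm _ (by simp) _ (by simp))
        (hs k i j hik.symm hjk.symm _ (by simp) _ (by simp))
  have anti : ∀ a b, D v a b = -D v b a := fun a b => by
    rw [hrot, hswap, ← hrot]
  have total : ∀ i ∈ I, ∀ j ∈ I, i ≠ j → 0 < D v (w i) (w j) ∨ 0 < D v (w j) (w i) :=
    fun i hi j hj hij => by
      rcases (hne i hi j hj hij).lt_or_gt with h | h
      · exact Or.inr (by rw [anti]; linarith)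
      · exact Or.inl h
  have trans : ∀ i ∈ I, ∀ j ∈ I, ∀ k ∈ I, i ≠ k → 0 < D v (w i) (w j) → 0 < D v (w j) (w k) →
      0 < D v (w i) (w k) := fun i hi j hj k hk hik h₁ h₂ => by
    have := hplk v (w i) (w j) (w k) u
    have : 0 < D v (w i) (w k) * D v (w j) u := by
      nlinarith [mul_pos h₁ (hu k hk), mul_pos (hu i hi) h₂]
    exact pos_of_mul_pos_left this (hu j hj).le
  rcases total i hi j hj hij with a | a <;> rcases total j hj k hk hjk with b | b <;>
    rcases total i hi k hk hik with c | c
  · exact sorted i hi j hj k hk hij hik hjk a b c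
  · exact sorted i hi j hj k hk hij hik hjk a b (trans i hi j hj k hk hik a b)
  · exact sorted i hi k hk j hj hik hij hjk.symm c b a
  · exact sorted k hk i hi j hj hik.symm hjk.symm hij c a b
  · exact sorted j hj i hi k hk hij.symm hjk hik a c b
  · exact sorted j hj k hk i hi hjk hij.symm hik.symm b c a
  · exact sorted k hk j hj i hi hjk.symm hik.symm hij.symm b a (trans k hk j hj i hi hik.symm b a)
  · exact sorted k hk j hj i hi hjk.symm hik.symm hij.symm b a c

/-- For `j ≠ i`, both `z j` and `z' j` are common neighbours of `z i`, `z' i`, and `z j` is a common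
neighbour of `v`, `z' i`; each family lies on one side of the corresponding line. -/
theorem B11_not_hasOutsideObstacleRepresentation : ¬ HasOutsideObstacleRepresentation B11 := by
  rintro ⟨p, C, hrep, hC⟩
  have gp := (inGeneralPosition_iff.1 hrep.2.1).2
  set z : Fin 5 → Plane := fun i => p (.z i) with hz
  set w : Fin 5 → Plane := fun i => p (.z' i) with hw
  have hs : ∀ i j k, i ≠ j → i ≠ k → ∀ x ∈ ({z j, w j} : Set Plane), ∀ y ∈ ({z k, w k} : Set Plane),
      0 < cross (z i) (w i) x * cross (z i) (w i) y := by
    intro i j k hij hik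
    rintro x (rfl | rfl) y (rfl | rfl) <;>
    · refine common_neighbors_same_side hrep hC (by simp) ?_ ?_ ?_ ?_ ?_ <;>
        simp [B11, B11NonEdge, hij, hik, hij.symm, hik.symm]
  have hv : ∀ i j k, i ≠ j → i ≠ k →
      0 < cross (p .v) (w i) (z j) * cross (p .v) (w i) (z k) := by
    intro i j k hij hik
    refine common_neighbors_same_side hrep hC (by simp) ?_ ?_ ?_ ?_ ?_ <;>
      simp [B11, B11NonEdge, hij.symm, hik.symm]
  have hw0 : ∀ i j, i ≠ j → cross (p .v) (w i) (w j) ≠ 0 := fun i j hij =>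
    gp _ _ _ (by simp) (by simp) (by simpa using hij)
  have hz0 : ∀ i j, cross (p .v) (w i) (z j) ≠ 0 := fun i j =>
    gp _ _ _ (by simp) (by simp) (by simp)
  classical
  -- the side of the line through `v` and `w i` on which the `z j` with `j ≠ i` lie
  have key : ∀ s : Fin 5 → Bool, ∃ i j k l, i ≠ j ∧ i ≠ k ∧ j ≠ k ∧ l ≠ i ∧ l ≠ j ∧ l ≠ k ∧
      s i = s j ∧ s i = s k := by decide
  obtain ⟨i, j, k, l, hij, hik, hjk, hli, hlj, hlk, eij, eik⟩ :=
    key fun i => decide (0 < cross (p .v) (w i) (z (i + 1)))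
  have side : ∀ i j, i ≠ j →
      (0 < cross (p .v) (w i) (z j) ↔ 0 < cross (p .v) (w i) (z (i + 1))) := fun i j hij =>
    pos_iff_pos_of_mul_pos (hv i j (i + 1) hij (by clear hij; revert i; decide))
  have side' : ∀ m ∈ ({i, j, k} : Set (Fin 5)), ∀ n, m ≠ n →
      (0 < cross (p .v) (w m) (z n) ↔ 0 < cross (p .v) (w i) (z (i + 1))) := by
    rintro m (rfl | rfl | rfl) n hmn
    · exact side _ _ hmn
    · rw [side _ _ hmn]; exact (decide_eq_decide.1 eij).symm
    · rw [side _ _ hmn]; exact (decide_eq_decide.1 eik).symm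
  have hl : ∀ m ∈ ({i, j, k} : Set (Fin 5)), m ≠ l := by
    rintro m (rfl | rfl | rfl) <;> exact Ne.symm ‹_›
  by_cases h : 0 < cross (p .v) (w i) (z (i + 1))
  · exact no_three_blocks_of_common_upper (D := cross) cross_rotate cross_swap cross_pluecker
      (I := {i, j, k}) (i := i) (j := j) (k := k) (u := z l) (v := p .v) (by simp) (by simp)
      (by simp) hij hik hjk (fun m hm => (side' m hm l (hl m hm)).2 h)
      (fun m _ n _ hmn => hw0 m n hmn) (fun m hm n _ hmn => (side' m hm n hmn).2 h) hs
  · have hneg : ∀ m ∈ ({i, j, k} : Set (Fin 5)), ∀ n, m ≠ n → 0 < -cross (p .v) (w m) (z n) :=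
      fun m hm n hmn => neg_pos.2 <| (hz0 m n).lt_or_gt.resolve_right fun hh =>
        h ((side' m hm n hmn).1 hh)
    -- In the mirrored case the bracket is negated; the Plücker relation is quadratic and does not
    -- change.
    exact no_three_blocks_of_common_upper (D := fun a b c => -cross a b c)
      (fun a b c => by rw [cross_rotate]) (fun a b c => by rw [cross_swap])
      (fun a b c d e => by simpa using cross_pluecker a b c d e)
      (I := {i, j, k}) (i := i) (j := j) (k := k) (u := z l) (v := p .v) (by simp) (by simp)
      (by simp) hij hik hjk (fun m hm => hneg m hm l (hl m hm))
      (fun m _ n _ hmn => neg_ne_zero.2 (hw0 m n hmn)) (fun m hm n _ hmn => hneg m hm n hmn)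
      (fun i j k hij hik x hx y hy => by simpa using hs i j k hij hik x hx y hy)

/-! ### An inside obstacle for `B₁₁` -/

/-- The vertices of `B₁₁` as a disjoint union. -/
def B11Vertex.equivSum : B11Vertex ≃ Fin 5 ⊕ Fin 5 ⊕ Unit where
  toFun
    | .z i => .inl i
    | .z' i => .inr (.inl i)
    | .v => .inr (.inr ())
  invFun
    | .inl i => .z i
    | .inr (.inl i) => .z' i
    | .inr (.inr _) => .v
  left_inv := by rintro (i | i | _) <;> rfl
  right_inv := by rintro (i | i | _) <;> rfl

instance : Fintype B11Vertex := Fintype.ofEquiv _ B11Vertex.equivSum.symm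

instance : DecidableRel B11NonEdge := fun a b => by
  cases a <;> cases b <;> unfold B11NonEdge <;> infer_instance

instance : DecidableRel B11.Adj := fun a b => by
  unfold B11; dsimp only; infer_instance

/-- The upper half of an almost regular decagon. -/
def decagonHalf : Fin 5 → ℤ × ℤ := ![(95, 31), (59, 81), (0, 100), (-59, 81), (-95, 31)]

/-- A placement of `B₁₁`: a decagon with opposite corners `z i` and `z' i`, and the vertex `v` close
to its centre. -/
def B11Placement : B11Vertex → ℤ × ℤ
  | .z i => decagonHalf i
  | .z' i => -decagonHalf i
  | .v => (1, 6)

/-- The triangle with the corners `(±25, 4)` and `(0, -21)` as a comb. -/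
theorem isComb_triangle :
    IsComb (fun x : ℝ => min 4 (|x| - 21)) 4 (fun i => 25 * ((i : ℝ) - 1)) 2 where
  two_le := le_rfl
  lt_succ i _ := by push_cast; linarith
  continuous := by fun_prop
  affine i hi x hx := by
    interval_cases i
    · norm_num at hx ⊢
      rw [abs_of_nonpos hx.2, min_eq_right (by linarith)]
      ring
    · norm_num at hx ⊢
      rw [abs_of_nonneg hx.1, min_eq_right (by linarith)]
      ring
  lt x hx := by
    norm_num at hx
    have : |x| < 25 := abs_lt.2 ⟨by linarith [hx.1], by linarith [hx.2]⟩
    exact (min_le_right _ _).trans_lt (by linarith)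
  eq x hx := by
    norm_num at hx
    refine min_eq_left ?_
    by_contra! h
    have : |x| < 25 := by linarith
    linarith [hx (by linarith [(abs_lt.1 this).1]), (abs_lt.1 this).2]

/-- The corners of the triangle. -/
def triangleCorner : Fin 3 → ℤ × ℤ := ![(25, 4), (-25, 4), (0, -21)]

theorem mem_triangle_iff (q : Plane) :
    q ∈ combRegion (fun x : ℝ => min 4 (|x| - 21)) 4 ↔ |q 0| - 21 < q 1 ∧ q 1 < 4 := by
  simp only [combRegion, mem_ofPred_eq, min_lt_iff]
  constructor
  · rintro ⟨h1 | h1, h2⟩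
    · exact absurd h1 h2.not_gt
    · exact ⟨h1, h2⟩
  · exact fun h => ⟨Or.inr h.1, h.2⟩

/-- A point of the triangle is a convex combination of the corners with positive weights, here
scaled to sum to `50`. All conditions on edges thus become integer inequalities at three corners. -/
theorem cross_pos_of_mem_triangle {a b q : Plane}
    (hq : q ∈ combRegion (fun x : ℝ => min 4 (|x| - 21)) 4)
    (h : ∀ k, 0 < cross a b (latticePoint (triangleCorner k))) : 0 < cross a b q := by
  rw [mem_triangle_iff] at hq
  obtain ⟨h1, h2⟩ := hq
  have h3 := abs_lt.1 (by linarith : |q 0| < q 1 + 21)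
  have e : 50 * cross a b q = (q 1 + 21 + q 0) * cross a b (latticePoint (triangleCorner 0)) +
      (q 1 + 21 - q 0) * cross a b (latticePoint (triangleCorner 1)) +
      (8 - 2 * q 1) * cross a b (latticePoint (triangleCorner 2)) := by
    have c2 : triangleCorner 2 = (0, -21) := rfl
    simp only [cross, latticePoint_zero, latticePoint_one, c2]
    simp only [triangleCorner, Matrix.cons_val_zero, Matrix.cons_val_one]
    push_cast
    ring
  have := mul_pos (by linarith : 0 < q 1 + 21 + q 0) (h 0)
  have := mul_pos (by linarith : 0 < q 1 + 21 - q 0) (h 1)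
  have := mul_pos (by linarith : 0 < 8 - 2 * q 1) (h 2)
  linarith

theorem B11_hasInsideObstacleRepresentation : HasInsideObstacleRepresentation B11 := by
  set C := combRegion (fun x : ℝ => min 4 (|x| - 21)) 4 with hC
  set p : B11Vertex → Plane := fun x => latticePoint (B11Placement x) with hp
  have hinj : Function.Injective B11Placement := by decide +kernel
  have hgp : InGeneralPosition p := by
    refine inGeneralPosition_iff.2 ⟨fun u y h => hinj ?_, ?_⟩
    · have h0 := congrArg (fun q : Plane => q 0) h
      have h1 := congrArg (fun q : Plane => q 1) h
      simp only [hp, latticePoint_zero, latticePoint_one, Int.cast_inj] at h0 h1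
      exact Prod.ext h0 h1
    · simp only [hp, cross_latticePoint, ne_eq, Int.cast_eq_zero]
      decide +kernel
  have hmem : ∀ y, p y ∉ C := by
    intro y hv
    rw [hC, mem_triangle_iff] at hv
    simp only [hp, latticePoint_zero, latticePoint_one] at hv
    norm_cast at hv
    revert y
    decide +kernel
  -- the triangle lies on one side of each edge
  have hedge : ∀ u y, B11.Adj u y →
      (∀ k, 0 < cross (p u) (p y) (latticePoint (triangleCorner k))) ∨
      (∀ k, 0 < cross (p y) (p u) (latticePoint (triangleCorner k))) ∨ (4 ≤ p u 1 ∧ 4 ≤ p y 1) := by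
    simp only [hp, cross_latticePoint, latticePoint_one]
    norm_cast
  -- Opposite corners of the decagon are antipodal, and their midpoint, the origin, lies in the
  -- triangle.
  have hblock : ∀ i, ¬ Disjoint (segment ℝ (p (.z i)) (p (.z' i))) C := fun i =>
    Set.not_disjoint_iff.2 ⟨0, ⟨1 / 2, 1 / 2, by norm_num, by norm_num, by norm_num, by
      apply Plane.ext' <;>
        simp [hp, B11Placement, latticePoint_zero, latticePoint_one]⟩,
      by rw [hC, mem_triangle_iff]; norm_num⟩
  -- `v` lies just above the top side of the triangle; a tenth of the way towards any `z' i` is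
  -- already inside.
  have hblockv : ∀ i, ¬ Disjoint (segment ℝ (p .v) (p (.z' i))) C := fun i => by
    refine Set.not_disjoint_iff.2 ⟨(9 / 10 : ℝ) • p .v + (1 / 10 : ℝ) • p (.z' i),
      ⟨9 / 10, 1 / 10, by norm_num, by norm_num, by norm_num, rfl⟩, ?_⟩
    rw [hC, mem_triangle_iff]
    simp only [hp, B11Placement, PiLp.add_apply, PiLp.smul_apply, latticePoint_zero,
      latticePoint_one, smul_eq_mul, sub_lt_iff_lt_add, abs_lt]
    have : -(54 + 210 - (decagonHalf i).2) < 9 - (decagonHalf i).1 ∧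
        9 - (decagonHalf i).1 < 54 + 210 - (decagonHalf i).2 ∧ 54 - (decagonHalf i).2 < 40 := by
      revert i; decide
    obtain ⟨h1, h2, h3⟩ := this
    have h1' : -(54 + 210 - ((decagonHalf i).2 : ℝ)) < 9 - (decagonHalf i).1 := by exact_mod_cast h1
    have h2' : 9 - ((decagonHalf i).1 : ℝ) < 54 + 210 - (decagonHalf i).2 := by exact_mod_cast h2
    have h3' : 54 - ((decagonHalf i).2 : ℝ) < 40 := by exact_mod_cast h3
    push_cast [Prod.fst_neg, Prod.snd_neg]
    refine ⟨⟨?_, ?_⟩, ?_⟩ <;> linarith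
  have hnon : ∀ u y, B11NonEdge u y → ¬ Disjoint (segment ℝ (p u) (p y)) C := by
    rintro (i | i | _) (j | j | _) h
    all_goals try exact h.elim
    · obtain rfl : i = j := h
      exact hblock i
    · exact hblockv j
  refine ⟨p, C, ⟨isComb_triangle.isOpenSimplePolygon, hgp, hmem, ?_⟩, ?_⟩
  · intro u y
    constructor
    · refine fun h => ⟨h.ne, Set.disjoint_left.2 fun q hq hqC => ?_⟩
      rcases hedge u y h with h1 | h1 | h1
      · exact Set.disjoint_left.1 (disjoint_segment_of_cross_nonpos
          (fun z hz => cross_pos_of_mem_triangle hz h1) (cross_self_left _ _).le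
          (cross_self_right _ _).le) hq hqC
      · exact Set.disjoint_left.1 (disjoint_segment_of_cross_nonpos
          (fun z hz => cross_pos_of_mem_triangle hz h1) (cross_self_right _ _).le
          (cross_self_left _ _).le) hq hqC
      · obtain ⟨s, t, hs, ht, hst, rfl⟩ := hq
        have := ((mem_triangle_iff _).1 hqC).2
        simp only [PiLp.add_apply, PiLp.smul_apply, smul_eq_mul] at this
        nlinarith [mul_le_mul_of_nonneg_left h1.1 hs, mul_le_mul_of_nonneg_left h1.2 ht]
    · rintro ⟨hne, hd⟩
      exact ⟨hne, fun h => hnon u y h hd, fun h => hnon y u h (by rwa [segment_symm])⟩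
  · -- the triangle is enclosed by a quadrilateral of edges
    have hab : B11.Adj (.z 0) (.z 3) := by decide
    have hbc : B11.Adj (.z 3) (.z' 1) := by decide
    have hcd : B11.Adj (.z' 1) (.z' 3) := by decide
    have hda : B11.Adj (.z' 3) (.z 0) := by decide
    have hpos : ∀ {u y w : B11Vertex}, 0 < ((B11Placement y).1 - (B11Placement u).1) *
        ((B11Placement w).2 - (B11Placement u).2) - ((B11Placement y).2 - (B11Placement u).2) *
        ((B11Placement w).1 - (B11Placement u).1) → 0 < cross (p u) (p y) (p w) := by
      intro u y w h
      simp only [hp, cross_latticePoint]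
      exact_mod_cast h
    have hf := (frontier_union_closedTriangle (hpos (u := .z 0) (y := .z 3) (w := .z' 3) (by decide))
      (hpos (u := .z 3) (y := .z' 1) (w := .z' 3) (by decide))).trans
      (Set.union_subset (Set.union_subset (Set.union_subset (segment_subset_drawing (p := p) hab)
        (segment_subset_drawing hbc)) (segment_subset_drawing hcd)) (segment_subset_drawing hda))
    have hdis := disjoint_unboundedComponent ((isBounded_closedTriangle (hpos (by decide))).union
      (isBounded_closedTriangle (hpos (by decide)))) hf
    intro q hq hqu
    refine Set.disjoint_left.1 hdis ?_ hqu
    have side : ∀ u y : B11Vertex, (∀ k, 0 < ((B11Placement y).1 - (B11Placement u).1) *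
        ((triangleCorner k).2 - (B11Placement u).2) - ((B11Placement y).2 - (B11Placement u).2) *
        ((triangleCorner k).1 - (B11Placement u).1)) → 0 < cross (p u) (p y) q := by
      intro u y h
      refine cross_pos_of_mem_triangle hq fun k => ?_
      simp only [hp, cross_latticePoint]
      exact_mod_cast h k
    -- The diagonal `z 3, z' 3` is a missing edge that crosses the obstacle, so both halves of the
    -- quadrilateral are needed.
    rcases le_total 0 (cross (p (.z 3)) (p (.z' 3)) q) with h | h
    · exact Or.inl ⟨(side _ _ (by decide)).le, h, (side _ _ (by decide)).le⟩
    · exact Or.inr ⟨(side _ _ (by decide)).le, (side _ _ (by decide)).le,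
        by rw [cross_swap]; linarith⟩

/-! ### Open sets and convex hulls in the plane -/

theorem convex_setOf_cross_nonneg (a b : Plane) : Convex ℝ {x | 0 ≤ cross a b x} :=
  convex_iff_segment_subset.2 fun _ hx _ hy _ hz => segment_subset_cross_nonneg hx hy hz

/-- A small move against the normal of `a b` stays in `U`. Thus open sets on one side of a line
avoid the line, and no line contains a nonempty open set. -/
theorem IsOpen.exists_cross_lt {U : Set Plane} (hU : IsOpen U) {a b z : Plane} (hab : a ≠ b)
    (hz : z ∈ U) : ∃ y ∈ U, cross a b y < cross a b z := by
  set n : Plane := !₂[-(b 1 - a 1), b 0 - a 0] with hn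
  have hc : ContinuousAt (fun t : ℝ => z - t • n) 0 := by fun_prop
  have he : ∀ᶠ t : ℝ in 𝓝[>] 0, z - t • n ∈ U :=
    (hc.eventually (hU.mem_nhds (by simpa using hz))).filter_mono nhdsWithin_le_nhds
  obtain ⟨t, ht, ht0⟩ := (he.and self_mem_nhdsWithin).exists
  refine ⟨_, ht, ?_⟩
  have hpos : 0 < (b 0 - a 0) ^ 2 + (b 1 - a 1) ^ 2 := by
    by_contra h
    refine hab (Plane.ext' ?_ ?_) <;> nlinarith [sq_nonneg (b 0 - a 0), sq_nonneg (b 1 - a 1)]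
  have : cross a b (z - t • n) =
      cross a b z - t * ((b 0 - a 0) ^ 2 + (b 1 - a 1) ^ 2) := by
    simp only [cross, hn, PiLp.sub_apply, PiLp.smul_apply, smul_eq_mul]
    simp; ring
  rw [this]
  have := mul_pos ht0 hpos
  linarith

theorem IsOpen.cross_pos {U : Set Plane} (hU : IsOpen U) {a b : Plane} (hab : a ≠ b)
    (h : ∀ z ∈ U, 0 ≤ cross a b z) {z : Plane} (hz : z ∈ U) : 0 < cross a b z := by
  obtain ⟨y, hy, hlt⟩ := hU.exists_cross_lt hab hz
  exact (h y hy).trans_lt hlt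

theorem IsOpen.exists_cross_ne_zero {U : Set Plane} (hU : IsOpen U) (hne : U.Nonempty)
    {a b : Plane} (hab : a ≠ b) : ∃ y ∈ U, cross a b y ≠ 0 := by
  obtain ⟨z, hz⟩ := hne
  by_cases h : cross a b z = 0
  · obtain ⟨y, hy, hlt⟩ := hU.exists_cross_lt hab hz
    exact ⟨y, hy, (hlt.trans_eq h).ne⟩
  · exact ⟨z, hz, h⟩

theorem IsCompact.convexJoin {E : Type*} [AddCommGroup E] [Module ℝ E] [TopologicalSpace E]
    [ContinuousAdd E] [ContinuousSMul ℝ E] {s t : Set E} (hs : IsCompact s) (ht : IsCompact t) :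
    IsCompact (convexJoin ℝ s t) := by
  have h := ((hs.prod ht).prod (isCompact_Icc (a := (0 : ℝ)) (b := 1))).image
    (f := fun q : (E × E) × ℝ => (1 - q.2) • q.1.1 + q.2 • q.1.2) (by fun_prop)
  convert h using 1
  ext x
  simp only [mem_convexJoin, segment_eq_image, mem_image, Prod.exists, mem_prod]
  constructor
  · rintro ⟨a, ha, b, hb, θ, hθ, rfl⟩
    exact ⟨a, b, θ, ⟨⟨ha, hb⟩, hθ⟩, rfl⟩
  · rintro ⟨a, b, θ, ⟨⟨ha, hb⟩, hθ⟩, rfl⟩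
    exact ⟨a, ha, b, hb, θ, hθ, rfl⟩

/-- Carathéodory in dimension two: three points suffice. It is used to carry compactness over to the
hull. -/
theorem convexHull_eq_convexJoin_convexJoin (A : Set Plane) :
    convexHull ℝ A = convexJoin ℝ A (convexJoin ℝ A A) := by
  apply subset_antisymm
  · rw [convexHull_eq_union]
    refine iUnion_subset fun t => iUnion_subset fun ht => iUnion_subset fun hi => ?_
    have hcard : t.card ≤ 3 := by
      have := hi.card_le_finrank_succ
      have h2 := Submodule.finrank_le (vectorSpan ℝ (range ((↑) : t → Plane)))
      simp at this h2
      omega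
    have h3 (x y z : Plane) (hx : x ∈ A) (hy : y ∈ A) (hz : z ∈ A) :
        convexHull ℝ {x, y, z} ⊆ convexJoin ℝ A (convexJoin ℝ A A) := by
      rw [convexHull_insert (by simp), convexHull_pair, ← convexJoin_singletons]
      exact convexJoin_mono (by simpa) (convexJoin_mono (by simpa) (by simpa))
    rcases t.eq_empty_or_nonempty with rfl | ⟨x, hx⟩
    · simp
    have hx' : x ∈ A := ht hx
    have hc1 : (t.erase x).card ≤ 2 := by rw [Finset.card_erase_of_mem hx]; omega
    have hsub : ∃ y ∈ A, ∃ z ∈ A, t ⊆ {x, y, z} := by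
      rcases (t.erase x).eq_empty_or_nonempty with h0 | ⟨y, hy⟩
      · refine ⟨x, hx', x, hx', fun w hw => ?_⟩
        by_contra hw'
        have : w ∈ t.erase x := Finset.mem_erase.2 ⟨by rintro rfl; simp at hw', hw⟩
        simp [h0] at this
      · have hc2 : ((t.erase x).erase y).card ≤ 1 := by
          rw [Finset.card_erase_of_mem hy]; omega
        have hy' : y ∈ A := ht (Finset.mem_of_mem_erase hy)
        rcases ((t.erase x).erase y).eq_empty_or_nonempty with h0 | ⟨z, hz⟩
        · refine ⟨y, hy', y, hy', fun w hw => ?_⟩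
          by_contra hw'
          simp only [Finset.mem_insert, Finset.mem_singleton, not_or] at hw'
          have : w ∈ (t.erase x).erase y :=
            Finset.mem_erase.2 ⟨hw'.2.1, Finset.mem_erase.2 ⟨hw'.1, hw⟩⟩
          simp [h0] at this
        · refine ⟨y, hy', z, ht (Finset.mem_of_mem_erase (Finset.mem_of_mem_erase hz)),
            fun w hw => ?_⟩
          by_contra hw'
          simp only [Finset.mem_insert, Finset.mem_singleton, not_or] at hw'
          exact hw'.2.2 (Finset.card_le_one.1 hc2 _
            (Finset.mem_erase.2 ⟨hw'.2.1, Finset.mem_erase.2 ⟨hw'.1, hw⟩⟩) _ hz)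
    obtain ⟨y, hy, z, hz, h⟩ := hsub
    refine (convexHull_mono ?_).trans (h3 x y z hx' hy hz)
    intro w hw
    simpa using h hw
  · have hc := convex_convexHull ℝ A
    have hA := subset_convexHull ℝ A
    have hj {s t : Set Plane} (hs : s ⊆ convexHull ℝ A) (ht : t ⊆ convexHull ℝ A) :
        convexJoin ℝ s t ⊆ convexHull ℝ A := fun x hx => by
      obtain ⟨a, ha, b, hb, h⟩ := mem_convexJoin.1 hx
      exact hc.segment_subset (hs ha) (ht hb) h
    exact hj hA (hj hA hA)

theorem isCompact_convexHull_plane {A : Set Plane} (hA : IsCompact A) :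
    IsCompact (convexHull ℝ A) := by
  rw [convexHull_eq_convexJoin_convexJoin]
  exact hA.convexJoin (hA.convexJoin hA)

/-- A corner `h` of the convex hull of a finite planar set has two neighbouring corners on the
boundary of the hull. -/
theorem exists_hull_neighbors {E : Set Plane} (hE : E.Finite) {h : Plane}
    (hx : h ∉ convexHull ℝ (E \ {h})) (hne : (E \ {h}).Nonempty)
    (hnd : ∀ k, k ≠ h → ∃ x ∈ E, cross h k x ≠ 0) :
    ∃ h₁ ∈ E, ∃ h₂ ∈ E, (∀ x ∈ E, 0 ≤ cross h h₁ x) ∧ (∀ x ∈ E, 0 ≤ cross h₂ h x) ∧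
      0 < cross h h₁ h₂ := by
  have hfin : (E \ {h}).Finite := hE.subset sdiff_subset
  obtain ⟨f, u, hfu, hf⟩ := geometric_hahn_banach_point_closed (convex_convexHull ℝ (E \ {h}))
    (hfin.isClosed_convexHull ℝ) hx
  set α := f !₂[1, 0] with hα
  set β := f !₂[0, 1] with hβ
  have hfe (y : Plane) : f y = α * y 0 + β * y 1 := by
    have : y = y 0 • !₂[1, 0] + y 1 • !₂[0, 1] := by apply Plane.ext' <;> simp
    conv_lhs => rw [this]
    rw [map_add, map_smul, map_smul, smul_eq_mul, smul_eq_mul]; ring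
  -- Coordinates around `h`, along the gradient of the separating functional and perpendicular to
  -- it. As `φ` is positive on the other points, `γ / φ` orders them by angle, and its extremes are
  -- the two neighbours.
  set φ : Plane → ℝ := fun y => α * (y 0 - h 0) + β * (y 1 - h 1) with hφ
  set γ : Plane → ℝ := fun y => α * (y 1 - h 1) - β * (y 0 - h 0) with hγ
  have hφpos : ∀ y ∈ E \ {h}, 0 < φ y := fun y hy => by
    have h1 := hf y (subset_convexHull ℝ _ hy)
    rw [hfe] at h1 hfu
    simp only [hφ]; linarith
  have hαβ : 0 < α ^ 2 + β ^ 2 := by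
    obtain ⟨y, hy⟩ := hne
    have := hφpos y hy
    by_contra hcon
    have h0 : α = 0 := by nlinarith [sq_nonneg α, sq_nonneg β]
    have h1 : β = 0 := by nlinarith [sq_nonneg α, sq_nonneg β]
    simp [hφ, h0, h1] at this
  have hcr (y z : Plane) : (α ^ 2 + β ^ 2) * cross h y z = φ y * γ z - γ y * φ z := by
    simp only [hφ, hγ, cross]; ring
  obtain ⟨h₁, hh₁, hmin⟩ := hfin.exists_minimalFor (fun y => γ y / φ y) _ hne
  obtain ⟨h₂, hh₂, hmax⟩ := hfin.exists_maximalFor (fun y => γ y / φ y) _ hne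
  have hmin' : ∀ y ∈ E \ {h}, γ h₁ / φ h₁ ≤ γ y / φ y := fun y hy =>
    (le_total _ _).elim id fun hle => hmin hy hle
  have hmax' : ∀ y ∈ E \ {h}, γ y / φ y ≤ γ h₂ / φ h₂ := fun y hy =>
    (le_total _ _).elim id fun hle => hmax hy hle
  have hle {y z : Plane} (hy : y ∈ E \ {h}) (hz : z ∈ E \ {h}) (hyz : γ y / φ y ≤ γ z / φ z) :
      0 ≤ cross h y z := by
    rw [div_le_div_iff₀ (hφpos _ hy) (hφpos _ hz)] at hyz
    refine nonneg_of_mul_nonneg_right ?_ hαβ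
    rw [hcr]; linarith
  have H1 : ∀ x ∈ E, 0 ≤ cross h h₁ x := fun x hxE => by
    by_cases hxh : x = h
    · rw [hxh, cross_self_left]
    · exact hle hh₁ ⟨hxE, hxh⟩ (hmin' x ⟨hxE, hxh⟩)
  refine ⟨h₁, hh₁.1, h₂, hh₂.1, H1, fun x hxE => ?_, ?_⟩
  · by_cases hxh : x = h
    · rw [hxh, cross_self_right]
    · rw [← cross_rotate]
      exact hle ⟨hxE, hxh⟩ hh₂ (hmax' x ⟨hxE, hxh⟩)
  · refine (H1 h₂ hh₂.1).lt_of_ne' fun h0 => ?_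
    obtain ⟨x, hxE, hx0⟩ := hnd h₁ hh₁.2
    have hxh : x ≠ h := by rintro rfl; exact hx0 (cross_self_left _ _)
    have e := hcr h₁ h₂
    rw [h0, mul_zero] at e
    have e1 : γ h₂ / φ h₂ ≤ γ h₁ / φ h₁ := by
      rw [div_le_div_iff₀ (hφpos _ hh₂) (hφpos _ hh₁)]; linarith
    have := hle ⟨hxE, hxh⟩ hh₁ ((hmax' x ⟨hxE, hxh⟩).trans e1)
    rw [cross_swap'] at this
    exact hx0 (le_antisymm (by linarith) (H1 x hxE))

/-! ### The boundary of a face away from the vertices -/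

section Face

variable {V : Type*} [Finite V] {G : SimpleGraph V} {p : V → Plane}

theorem isClosed_segment (a b : Plane) : IsClosed (segment ℝ a b) := by
  rw [← convexHull_pair]
  exact (toFinite {a, b}).isClosed_convexHull ℝ

theorem isClosed_straightLineDrawing : IsClosed (straightLineDrawing G p) := by
  refine (finite_range p).isClosed.union ?_
  have : {x | ∃ u v : V, G.Adj u v ∧ x ∈ segment ℝ (p u) (p v)} =
      ⋃ u : V, ⋃ v : V, ⋃ _ : G.Adj u v, segment ℝ (p u) (p v) := by
    ext x; simp
  rw [this]
  exact isClosed_iUnion_of_finite fun u => isClosed_iUnion_of_finite fun v =>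
    isClosed_iUnion_of_finite fun _ => isClosed_segment _ _

theorem cross_eq_zero_of_mem_segment {a b x : Plane} (h : x ∈ segment ℝ a b) :
    cross a b x = 0 :=
  le_antisymm
    (segment_subset_cross_nonpos (cross_self_left _ _).le (cross_self_right _ _).le h)
    (segment_subset_cross_nonneg (cross_self_left _ _).ge (cross_self_right _ _).ge h)

/-- Near a point of the drawing that is no vertex, the drawing consists of the edges through that
point. -/
theorem exists_ball_inter_drawing {x : Plane} (hx : x ∉ range p) :
    ∃ r > 0, ∀ y ∈ Metric.ball x r, y ∈ straightLineDrawing G p →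
      ∃ c d, G.Adj c d ∧ x ∈ segment ℝ (p c) (p d) ∧ y ∈ segment ℝ (p c) (p d) := by
  set N : Set Plane := range p ∪ ⋃ u : V, ⋃ v : V,
    ⋃ _ : G.Adj u v ∧ x ∉ segment ℝ (p u) (p v), segment ℝ (p u) (p v) with hN
  have hNc : IsClosed N := (finite_range p).isClosed.union <|
    isClosed_iUnion_of_finite fun u => isClosed_iUnion_of_finite fun v =>
      isClosed_iUnion_of_finite fun _ => isClosed_segment _ _
  have hxN : x ∉ N := by
    rintro (h | h)
    · exact hx h
    · simp only [mem_iUnion] at h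
      obtain ⟨u, v, h, h'⟩ := h
      exact h.2 h'
  obtain ⟨r, hr, hrN⟩ := Metric.isOpen_iff.1 hNc.isOpen_compl x hxN
  refine ⟨r, hr, fun y hy hyD => ?_⟩
  have hyN := hrN hy
  rcases hyD with h | ⟨c, d, hcd, h⟩
  · exact absurd (Or.inl h) hyN
  · refine ⟨c, d, hcd, ?_, h⟩
    by_contra hxs
    exact hyN (Or.inr (by simp only [mem_iUnion]; exact ⟨c, d, ⟨hcd, hxs⟩, h⟩))

/-- Walking from a point of `F` near `x` towards a point of the edge slightly closer to `a`, one
must leave `F` through some edge at `x`. The exit point shows that `closure F` continues along that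
edge, away from an end `d` other than `a`. -/
theorem exists_edge_of_mem_closure_face {F : Set Plane} (hFo : IsOpen F)
    (hFD : Disjoint F (straightLineDrawing G p)) (hfr : closure F \ F ⊆ straightLineDrawing G p)
    (hp : Function.Injective p) {x : Plane} (hxF : x ∈ closure F) (hx : x ∉ range p) {a b : V}
    (hab : G.Adj a b) (hxab : x ∈ segment ℝ (p a) (p b)) :
    ∃ c d, G.Adj c d ∧ x ∈ segment ℝ (p c) (p d) ∧ d ≠ a ∧
      ∃ t : ℝ, 0 < t ∧ x + t • (x - p d) ∈ closure F := by
  obtain ⟨r, hr, hball⟩ := exists_ball_inter_drawing (G := G) hx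
  have hpab : p a ≠ p b := hp.ne hab.ne
  obtain ⟨y, ⟨hyF, hyr⟩, hyab⟩ := (hFo.inter Metric.isOpen_ball).exists_cross_ne_zero
    (mem_closure_iff_nhds'.1 hxF _ (Metric.ball_mem_nhds x hr) |>.elim
      fun y hy => ⟨y.1, y.2, hy⟩) hpab
  -- a point of the edge slightly closer to `p a`
  have hxa : x ≠ p a := fun h => hx ⟨a, h.symm⟩
  obtain ⟨w, ⟨hwr, hwab⟩, ε, hε, hε1, rfl⟩ : ∃ w, (w ∈ Metric.ball x r ∧
      w ∈ segment ℝ (p a) (p b)) ∧ ∃ ε : ℝ, 0 < ε ∧ ε < 1 ∧ w = x + ε • (p a - x) := by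
    have hc : ContinuousAt (fun t : ℝ => x + t • (p a - x)) 0 := by fun_prop
    have he : ∀ᶠ t : ℝ in 𝓝[>] 0, x + t • (p a - x) ∈ Metric.ball x r :=
      (hc.eventually (Metric.isOpen_ball.mem_nhds (by simpa))).filter_mono nhdsWithin_le_nhds
    have he1 : ∀ᶠ t : ℝ in 𝓝[>] 0, t < 1 :=
      (eventually_lt_nhds one_pos).filter_mono nhdsWithin_le_nhds
    obtain ⟨t, ⟨ht, ht1⟩, ht0⟩ := ((he.and he1).and self_mem_nhdsWithin).exists
    refine ⟨_, ⟨ht, ?_⟩, t, ht0, ht1, rfl⟩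
    refine (convex_segment (p a) (p b)).segment_subset hxab (left_mem_segment ℝ _ _) ?_
    exact ⟨1 - t, t, by linarith, le_of_lt ht0, by ring, by module⟩
  set w := x + ε • (p a - x) with hw
  have hwD : w ∈ straightLineDrawing G p := segment_subset_drawing hab hwab
  obtain ⟨z, hz, hzf⟩ : ∃ z ∈ segment ℝ y w, z ∈ frontier F := by
    by_contra! hcon
    have := (convex_segment y w).isPreconnected.subset_of_frontier
      (disjoint_left.2 hcon) ⟨y, left_mem_segment ℝ _ _, hyF⟩
    exact disjoint_left.1 hFD (this (right_mem_segment ℝ _ _)) hwD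
  rw [hFo.frontier_eq] at hzf
  have hzr : z ∈ Metric.ball x r := (convex_ball x r).segment_subset hyr hwr hz
  obtain ⟨c, d, hcd, hxcd, hzcd⟩ := hball z hzr (hfr hzf)
  obtain ⟨s, t, hs, ht, hst, rfl⟩ := hz
  have hzc : cross (p a) (p b) (s • y + t • w) = s * cross (p a) (p b) y := by
    rw [cross_combo _ _ _ _ hst, cross_eq_zero_of_mem_segment hwab]; ring
  -- if the hit point is on the line of the edge, then it is `w`
  have hz0 (h : cross (p a) (p b) (s • y + t • w) = 0) : s • y + t • w = w := by
    rw [hzc] at h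
    have hs0 : s = 0 := (mul_eq_zero.1 h).resolve_right hyab
    have ht1 : t = 1 := by linarith
    simp [hs0, ht1]
  set z := s • y + t • w with hzdef
  have hwx : w ≠ x := by
    rw [hw]
    intro h
    have : ε • (p a - x) = 0 := by simpa using h
    rcases smul_eq_zero.1 this with h | h
    · exact hε.ne' h
    · exact hxa (sub_eq_zero.1 h).symm
  have hzx : z ≠ x := fun h => hwx ((hz0 (by rw [h]; exact cross_eq_zero_of_mem_segment hxab)) ▸ h)
  have hwedge (t : ℝ) (ht : 0 < t) : w ≠ x + t • (x - p a) := by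
    rw [hw]
    intro h
    have : (ε + t) • (p a - x) = 0 := by
      have h' := sub_eq_zero.2 h
      rw [← h']; module
    rcases smul_eq_zero.1 this with h | h
    · linarith
    · exact hxa (sub_eq_zero.1 h).symm
  -- the hit point lies beyond `x`, seen from one end of its edge
  have key : ∀ c d, G.Adj c d → x ∈ segment ℝ (p c) (p d) → ∀ t : ℝ, 0 < t →
      z = x + t • (x - p d) → ∃ c d, G.Adj c d ∧ x ∈ segment ℝ (p c) (p d) ∧ d ≠ a ∧
      ∃ t : ℝ, 0 < t ∧ x + t • (x - p d) ∈ closure F := by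
    intro c d hcd hxcd t ht hzt
    refine ⟨c, d, hcd, hxcd, ?_, t, ht, hzt ▸ hzf.1⟩
    -- If `d = a`, the exit point would lie on the line `a b` and hence be `w`; but `w` is on the
    -- same side of `x` as `a`.
    rintro rfl
    have : cross (p d) (p b) z = 0 := by
      have h1 : cross (p d) (p b) z = (1 + t) * cross (p d) (p b) x := by
        rw [hzt]
        simp only [cross, PiLp.add_apply, PiLp.sub_apply, PiLp.smul_apply, smul_eq_mul]; ring
      rw [h1, cross_eq_zero_of_mem_segment hxab, mul_zero]
    exact hwedge t ht ((hz0 this).symm.trans hzt)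
  obtain ⟨s1, t1, hs1, ht1, hst1, e1⟩ := hxcd
  obtain ⟨s2, t2, hs2, ht2, hst2, e2⟩ := hzcd
  have hs1' : 0 < s1 := hs1.lt_of_ne' fun h => hx ⟨d, by
    rw [← e1, h, show t1 = 1 by linarith]; simp⟩
  have ht1' : 0 < t1 := ht1.lt_of_ne' fun h => hx ⟨c, by
    rw [← e1, h, show s1 = 1 by linarith]; simp⟩
  have hxcd : x ∈ segment ℝ (p c) (p d) := ⟨s1, t1, hs1, ht1, hst1, e1⟩
  rcases lt_trichotomy t1 t2 with h | h | h
  · refine key d c hcd.symm (by rwa [segment_symm]) ((t2 - t1) / t1) (div_pos (by linarith) ht1') ?_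
    have : x - p c = t1 • (p d - p c) := by
      rw [← e1, show s1 = 1 - t1 by linarith]; module
    rw [this, smul_smul, div_mul_cancel₀ _ ht1'.ne', ← e1, ← e2,
      show s1 = 1 - t1 by linarith, show s2 = 1 - t2 by linarith]
    module
  · exact absurd (by rw [← e1, ← e2, h, show s1 = s2 by linarith]) hzx
  · refine key c d hcd hxcd ((s2 - s1) / s1) (div_pos (by linarith) hs1') ?_
    have : x - p d = s1 • (p c - p d) := by
      rw [← e1, show t1 = 1 - s1 by linarith]; module
    rw [this, smul_smul, div_mul_cancel₀ _ hs1'.ne', ← e1, ← e2,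
      show t1 = 1 - s1 by linarith, show t2 = 1 - s2 by linarith]
    module

/-- Two applications of the previous lemma: the end found first is the one avoided in the second. -/
theorem exists_two_edges_of_mem_closure_face {F : Set Plane} (hFo : IsOpen F)
    (hFD : Disjoint F (straightLineDrawing G p)) (hfr : closure F \ F ⊆ straightLineDrawing G p)
    (hp : Function.Injective p) {x : Plane} (hxF : x ∈ closure F) (hx' : x ∉ F)
    (hx : x ∉ range p) :
    ∃ a b c d, G.Adj a b ∧ G.Adj c d ∧ x ∈ segment ℝ (p a) (p b) ∧ x ∈ segment ℝ (p c) (p d) ∧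
      b ≠ d ∧ (∃ t : ℝ, 0 < t ∧ x + t • (x - p b) ∈ closure F) ∧
      ∃ t : ℝ, 0 < t ∧ x + t • (x - p d) ∈ closure F := by
  obtain h | ⟨a, b, hab, hxab⟩ := hfr ⟨hxF, hx'⟩
  · exact absurd h hx
  obtain ⟨a, b, hab, hxab, -, hb⟩ :=
    exists_edge_of_mem_closure_face hFo hFD hfr hp hxF hx hab hxab
  obtain ⟨c, d, hcd, hxcd, hdb, hd⟩ := exists_edge_of_mem_closure_face hFo hFD hfr hp hxF hx
    hab.symm (by rwa [segment_symm])
  exact ⟨a, b, c, d, hab, hcd, hxab, hxcd, hdb.symm, hb, hd⟩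

end Face

/-! ### Corners of the convex hull of a face -/

theorem subsingleton_segment_inter_segment {a b c d : Plane} (h : cross a b c ≠ 0) :
    (segment ℝ a b ∩ segment ℝ c d).Subsingleton := by
  rintro x ⟨hx, s, t, -, -, hst, rfl⟩ y ⟨hy, s', t', -, -, hst', rfl⟩
  have e := cross_eq_zero_of_mem_segment hx
  have e' := cross_eq_zero_of_mem_segment hy
  rw [cross_combo _ _ _ _ hst] at e
  rw [cross_combo _ _ _ _ hst'] at e'
  obtain rfl : s = 1 - t := by linarith
  obtain rfl : s' = 1 - t' := by linarith
  have : (t - t') * cross a b c = 0 := by linear_combination t * e' - t' * e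
  rcases mul_eq_zero.1 this with h' | h'
  · rw [sub_eq_zero.1 h']
  · exact absurd h' h

/-- `F` is an open bounded set whose boundary is contained in `D`. -/
structure IsBoundedFace (D F : Set Plane) : Prop where
  isOpen : IsOpen F
  isBounded : Bornology.IsBounded F
  nonempty : F.Nonempty
  disjoint : Disjoint F D
  closure_sdiff : closure F \ F ⊆ D

/-- The corners of the convex hull of the closure of `F`. -/
def hullCorners (F : Set Plane) : Set Plane :=
  (convexHull ℝ (closure F)).extremePoints ℝ

section Corners

variable {F : Set Plane}

theorem hullCorners_subset_closure : hullCorners F ⊆ closure F :=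
  extremePoints_convexHull_subset

theorem disjoint_hullCorners (hF : IsOpen F) : Disjoint F (hullCorners F) :=
  (disjoint_interior_extremePoints _).mono_left
    (interior_maximal (subset_closure.trans (subset_convexHull ℝ _)) hF)

/-- `x` lies strictly between two points of the hull. -/
theorem not_mem_hullCorners {x q : Plane} {t : ℝ} (ht : 0 < t) (hq : q ∈ convexHull ℝ (closure F))
    (hqx : q ≠ x) (h : x + t • (x - q) ∈ convexHull ℝ (closure F)) : x ∉ hullCorners F := by
  intro hx
  refine hqx (hx.2 hq h ⟨t / (1 + t), 1 / (1 + t), by positivity, by positivity, ?_, ?_⟩)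
  · field_simp; ring
  · have : (1 + t) ≠ 0 := by positivity
    rw [div_eq_inv_mul, div_eq_inv_mul, mul_smul, mul_smul, ← smul_add, inv_smul_eq_iff₀ this]
    module

variable {V : Type*} [Finite V] {G : SimpleGraph V} {p : V → Plane}

/-- A corner that is no vertex lies on two edges. If these were the same edge, the face would
continue along it on both sides of the corner, contradicting extremality. By general position, two
different edges meet in at most one point. -/
theorem finite_hullCorners (hF : IsBoundedFace (straightLineDrawing G p) F)
    (hp : InGeneralPosition p) : (hullCorners F).Finite := by
  rw [inGeneralPosition_iff] at hp
  have hfin : (range p ∪ ⋃ a : V, ⋃ b : V, ⋃ c : V, ⋃ d : V,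
      ⋃ _ : (segment ℝ (p a) (p b) ∩ segment ℝ (p c) (p d)).Subsingleton,
        segment ℝ (p a) (p b) ∩ segment ℝ (p c) (p d)).Finite :=
    (finite_range p).union <| finite_iUnion fun a => finite_iUnion fun b =>
      finite_iUnion fun c => finite_iUnion fun d => finite_iUnion fun h => h.finite
  refine hfin.subset fun x hx => ?_
  by_cases hxv : x ∈ range p
  · exact Or.inl hxv
  have hxF : x ∉ F := disjoint_right.1 (disjoint_hullCorners hF.isOpen) hx
  obtain ⟨a, b, c, d, hab, hcd, hxab, hxcd, hbd, ⟨t, ht, hz⟩, ⟨t', ht', hz'⟩⟩ :=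
    exists_two_edges_of_mem_closure_face hF.isOpen hF.disjoint hF.closure_sdiff hp.1
      (hullCorners_subset_closure hx) hxF hxv
  right
  simp only [mem_iUnion]
  refine ⟨a, b, c, d, ?_, hxab, hxcd⟩
  by_cases hda : d = a
  · subst hda
    by_cases hcb : c = b
    · subst hcb
      exfalso
      -- both points lie on the same edge, on different sides of `x`
      obtain ⟨s, r, hs, hr, hsr, e⟩ := hxab
      have hs' : s ≠ 0 := fun h => hxv ⟨c, by rw [← e, h, show r = 1 by linarith]; simp⟩
      have hr' : r ≠ 0 := fun h => hxv ⟨d, by rw [← e, h, show s = 1 by linarith]; simp⟩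
      have hs := hs.lt_of_ne' hs'
      have hr := hr.lt_of_ne' hr'
      have hxd : x + t • (x - p c) ≠ x := by
        intro h
        have : t • (x - p c) = 0 := by simpa using h
        rcases smul_eq_zero.1 this with h | h
        · exact ht.ne' h
        · exact hxv ⟨c, (sub_eq_zero.1 h).symm⟩
      have hK := subset_convexHull ℝ (closure F)
      refine not_mem_hullCorners (t := t' * r / (t * s))
        (by positivity) (hK hz) hxd ?_ hx
      convert hK hz' using 2
      have : x - (x + t • (x - p c)) = (t * s / r) • (x - p d) := by
        have h1 : x - p c = s • (p d - p c) := by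
          rw [← e, show r = 1 - s by linarith]; module
        have h2 : x - p d = -(r • (p d - p c)) := by
          rw [← e, show s = 1 - r by linarith]; module
        rw [h1, h2, sub_add_cancel_left, smul_neg, smul_smul, smul_smul]
        congr 2
        field_simp
      rw [this, smul_smul]
      congr 1
      field_simp
    · exact subsingleton_segment_inter_segment (hp.2 d b c hab.ne hcd.ne.symm (Ne.symm hcb))
  · rw [segment_symm ℝ (p c)]
    exact subsingleton_segment_inter_segment (hp.2 a b d hab.ne (Ne.symm hda) hbd)

/-- Krein–Milman; the closure can be dropped because there are finitely many corners. -/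
theorem convexHull_hullCorners (hF : IsBoundedFace (straightLineDrawing G p) F)
    (hp : InGeneralPosition p) :
    convexHull ℝ (hullCorners F) = convexHull ℝ (closure F) := by
  rw [← ((finite_hullCorners hF hp).isClosed_convexHull ℝ).closure_eq]
  exact closure_convexHull_extremePoints
    (isCompact_convexHull_plane hF.isBounded.isCompact_closure) (convex_convexHull ℝ _)

/-- The corners are not all on a line because the hull contains the open set `F`, and sign
conditions on the corners extend to the hull by convexity. -/
theorem exists_neighbors_of_mem_hullCorners (hF : IsBoundedFace (straightLineDrawing G p) F)
    (hp : InGeneralPosition p) {h : Plane} (hh : h ∈ hullCorners F) :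
    ∃ h₁ ∈ hullCorners F, ∃ h₂ ∈ hullCorners F,
      (∀ x ∈ convexHull ℝ (closure F), 0 ≤ cross h h₁ x) ∧
      (∀ x ∈ convexHull ℝ (closure F), 0 ≤ cross h₂ h x) ∧ 0 < cross h h₁ h₂ := by
  have hull := convexHull_hullCorners hF hp
  have hFK : F ⊆ convexHull ℝ (closure F) := subset_closure.trans (subset_convexHull ℝ _)
  have hEK : hullCorners F ⊆ convexHull ℝ (closure F) := extremePoints_subset
  have hnd : ∀ k, k ≠ h → ∃ x ∈ hullCorners F, cross h k x ≠ 0 := by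
    intro k hk
    by_contra! hcon
    obtain ⟨y, hy, hy0⟩ := hF.isOpen.exists_cross_ne_zero hF.nonempty hk.symm
    have h1 : y ∈ convexHull ℝ (hullCorners F) := hull ▸ hFK hy
    have h2 := convexHull_min (fun x hx => (hcon x hx).ge) (convex_setOf_cross_nonneg h k) h1
    have h3 := convexHull_min (fun x hx => by
      simp only [mem_ofPred_eq]; rw [cross_swap, hcon x hx, neg_zero])
      (convex_setOf_cross_nonneg k h) h1
    change 0 ≤ cross h k y at h2; change 0 ≤ cross k h y at h3
    rw [cross_swap] at h3
    exact hy0 (by linarith)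
  have hx : h ∉ convexHull ℝ (hullCorners F \ {h}) := fun hx =>
    ((convex_convexHull ℝ _).mem_extremePoints_iff_mem_sdiff_convexHull_sdiff.1 hh).2
      (convexHull_mono (sdiff_subset_sdiff_left hEK) hx)
  have hne : (hullCorners F \ {h}).Nonempty := by
    have : ∃ k : Plane, k ≠ h := exists_ne h
    obtain ⟨k, hk⟩ := this
    obtain ⟨x, hx, hx0⟩ := hnd k hk
    exact ⟨x, hx, by rintro rfl; exact hx0 (cross_self_left _ _)⟩
  obtain ⟨h₁, m₁, h₂, m₂, c₁, c₂, c₃⟩ :=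
    exists_hull_neighbors (finite_hullCorners hF hp) hx hne hnd
  refine ⟨h₁, m₁, h₂, m₂, fun x hx => ?_, fun x hx => ?_, c₃⟩
  · exact convexHull_min c₁ (convex_setOf_cross_nonneg h h₁) (hull ▸ hx)
  · exact convexHull_min c₂ (convex_setOf_cross_nonneg h₂ h) (hull ▸ hx)

end Corners

/-! ### Inside obstacles of triangle-free graphs -/

section InsideFace

variable {V : Type*} {G : SimpleGraph V} {p : V → Plane} {C F : Set Plane}

theorem adj_of_cross_nonpos (hrep : IsObstacleRepresentation G p C) {a b : Plane}
    (hC : ∀ z ∈ C, 0 < cross a b z) {u v : V} (huv : u ≠ v) (hu : cross a b (p u) ≤ 0)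
    (hv : cross a b (p v) ≤ 0) : G.Adj u v :=
  (hrep.2.2.2 u v).2 ⟨huv, disjoint_segment_of_cross_nonpos hC hu hv⟩

theorem pos_of_subset_face (hF : IsBoundedFace (straightLineDrawing G p) F) (hCF : C ⊆ F)
    {a b : Plane} (hab : a ≠ b) (hK : ∀ x ∈ convexHull ℝ (closure F), 0 ≤ cross a b x) :
    ∀ z ∈ C, 0 < cross a b z := fun _ hz =>
  hF.isOpen.cross_pos hab (fun y hy => hK y (subset_convexHull ℝ _ (subset_closure hy))) (hCF hz)

/-- If the corner `h` of the hull has opposite edges ending in `b` and `d`, then so does every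
neighbouring corner `k`. -/
theorem opposite_of_hull_neighbor [Finite V] (hrep : IsObstacleRepresentation G p C)
    (h3 : ∀ a b c, G.Adj a b → G.Adj b c → ¬ G.Adj a c)
    (hF : IsBoundedFace (straightLineDrawing G p) F) (hCF : C ⊆ F)
    {u w h k : Plane} (huw : u ≠ w) (hK : ∀ x ∈ convexHull ℝ (closure F), 0 ≤ cross u w x)
    (hh : h ∈ hullCorners F) (hk : k ∈ hullCorners F) (hhk : k ≠ h)
    (hh0 : cross u w h = 0) (hk0 : cross u w k = 0) {b d : V} (hbd : b ≠ d)
    (hb : ∃ t : ℝ, 0 < t ∧ h + t • (h - p b) ∈ convexHull ℝ (closure F))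
    (hd : ∃ t : ℝ, 0 < t ∧ h + t • (h - p d) ∈ convexHull ℝ (closure F)) :
    k ∉ range p ∧ (∃ t : ℝ, 0 < t ∧ k + t • (k - p b) ∈ convexHull ℝ (closure F)) ∧
      ∃ t : ℝ, 0 < t ∧ k + t • (k - p d) ∈ convexHull ℝ (closure F) := by
  have hC := pos_of_subset_face hF hCF huw hK
  have hle {x : Plane} (hx : cross u w x = 0) {v : V}
      (hv : ∃ t : ℝ, 0 < t ∧ x + t • (x - p v) ∈ convexHull ℝ (closure F)) :
      cross u w (p v) ≤ 0 := by
    obtain ⟨t, ht, hz⟩ := hv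
    have := hK _ hz
    rw [cross_add_smul_sub, hx] at this
    nlinarith
  have adj := fun {x y : V} => adj_of_cross_nonpos hrep hC (u := x) (v := y)
  -- Both ends lie beyond the line of the hull side, since their opposite rays from `h` enter the
  -- hull. The obstacle is strictly on the other side, so any two vertices beyond the line are
  -- adjacent; a third one besides `b`, `d` would give a triangle.
  have hbd' : G.Adj b d := adj hbd (hle hh0 hb) (hle hh0 hd)
  have hmem {v : V} (hv : cross u w (p v) ≤ 0) : v = b ∨ v = d := by
    by_contra! hcon
    exact h3 v b d (adj hcon.1 hv (hle hh0 hb)) hbd' (adj hcon.2 hv (hle hh0 hd))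
  have hkp : k ∉ range p := by
    rintro ⟨v, rfl⟩
    have hkK : p v ∈ convexHull ℝ (closure F) := extremePoints_subset hk
    -- A vertex at `k` would be `b` or `d`; then `h` would lie between `k` and another point of the
    -- hull and not be a corner.
    rcases hmem hk0.le with rfl | rfl
    · obtain ⟨t, ht, hz⟩ := hb
      exact not_mem_hullCorners ht hkK hhk hz hh
    · obtain ⟨t, ht, hz⟩ := hd
      exact not_mem_hullCorners ht hkK hhk hz hh
  have hkF : k ∉ F := disjoint_right.1 (disjoint_hullCorners hF.isOpen) hk
  obtain ⟨-, v, -, v', -, -, -, -, hvv, ⟨t, ht, hz⟩, t', ht', hz'⟩ :=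
    exists_two_edges_of_mem_closure_face hF.isOpen hF.disjoint hF.closure_sdiff hrep.2.1.1
      (hullCorners_subset_closure hk) hkF hkp
  have hz : ∃ t : ℝ, 0 < t ∧ k + t • (k - p v) ∈ convexHull ℝ (closure F) :=
    ⟨t, ht, subset_convexHull ℝ _ hz⟩
  have hz' : ∃ t : ℝ, 0 < t ∧ k + t • (k - p v') ∈ convexHull ℝ (closure F) :=
    ⟨t', ht', subset_convexHull ℝ _ hz'⟩
  refine ⟨hkp, ?_⟩
  rcases hmem (hle hk0 hz) with rfl | rfl <;> rcases hmem (hle hk0 hz') with rfl | rfl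
  · exact absurd rfl hvv
  · exact ⟨hz, hz'⟩
  · exact ⟨hz', hz⟩
  · exact absurd rfl hvv

/-- A ray from `h` away from `q` into the cone spanned by `k₁ - h` and `k₂ - h` moves away from `q`;
hence `k₁` or `k₂` is farther from `q` than `h`. -/
theorem exists_dist_lt_of_cone {h k₁ k₂ q : Plane} {t : ℝ} (ht : 0 < t) (hq : h ≠ q)
    (hk : 0 < cross h k₁ k₂) (h1 : 0 ≤ cross h k₁ (h + t • (h - q)))
    (h2 : 0 ≤ cross k₂ h (h + t • (h - q))) : dist h q < dist k₁ q ∨ dist h q < dist k₂ q := by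
  by_contra! hcon
  obtain ⟨c1, c2⟩ := hcon
  simp only [EuclideanSpace.dist_eq, Real.dist_eq, Fin.sum_univ_two, sq_abs] at c1 c2
  rw [Real.sqrt_le_sqrt_iff (by positivity)] at c1 c2
  have hpos : 0 < (h 0 - q 0) ^ 2 + (h 1 - q 1) ^ 2 := by
    by_contra hn
    exact hq (Plane.ext' (by nlinarith [sq_nonneg (h 0 - q 0), sq_nonneg (h 1 - q 1)])
      (by nlinarith [sq_nonneg (h 0 - q 0), sq_nonneg (h 1 - q 1)]))
  have d1 : (k₁ 0 - h 0) * (h 0 - q 0) + (k₁ 1 - h 1) * (h 1 - q 1) ≤ 0 := by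
    nlinarith [sq_nonneg (k₁ 0 - h 0), sq_nonneg (k₁ 1 - h 1)]
  have d2 : (k₂ 0 - h 0) * (h 0 - q 0) + (k₂ 1 - h 1) * (h 1 - q 1) ≤ 0 := by
    nlinarith [sq_nonneg (k₂ 0 - h 0), sq_nonneg (k₂ 1 - h 1)]
  have e : t * cross h k₁ k₂ * ((h 0 - q 0) ^ 2 + (h 1 - q 1) ^ 2) =
      cross k₂ h (h + t • (h - q)) * ((k₁ 0 - h 0) * (h 0 - q 0) + (k₁ 1 - h 1) * (h 1 - q 1)) +
      cross h k₁ (h + t • (h - q)) * ((k₂ 0 - h 0) * (h 0 - q 0) + (k₂ 1 - h 1) * (h 1 - q 1)) := by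
    simp only [cross, PiLp.add_apply, PiLp.sub_apply, PiLp.smul_apply, smul_eq_mul]; ring
  have := mul_pos (mul_pos ht hk) hpos
  have := mul_nonpos_of_nonneg_of_nonpos h1 d2
  have := mul_nonpos_of_nonneg_of_nonpos h2 d1
  linarith

/-- In a triangle-free graph, all corners of the hull of the face of the obstacle are vertices. -/
theorem hullCorners_subset_range [Finite V] (hrep : IsObstacleRepresentation G p C)
    (h3 : ∀ a b c, G.Adj a b → G.Adj b c → ¬ G.Adj a c)
    (hF : IsBoundedFace (straightLineDrawing G p) F) (hCF : C ⊆ F) :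
    hullCorners F ⊆ range p := by
  intro h₀ hh₀
  by_contra hp₀
  have hhF : h₀ ∉ F := disjoint_right.1 (disjoint_hullCorners hF.isOpen) hh₀
  obtain ⟨-, b, -, d, -, -, -, -, hbd, ⟨t, ht, hz⟩, t', ht', hz'⟩ :=
    exists_two_edges_of_mem_closure_face hF.isOpen hF.disjoint hF.closure_sdiff hrep.2.1.1
      (hullCorners_subset_closure hh₀) hhF hp₀
  set T : Set Plane := {h | h ∈ hullCorners F ∧ h ∉ range p ∧
    (∃ t : ℝ, 0 < t ∧ h + t • (h - p b) ∈ convexHull ℝ (closure F)) ∧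
    ∃ t : ℝ, 0 < t ∧ h + t • (h - p d) ∈ convexHull ℝ (closure F)} with hT
  have hTfin : T.Finite := (finite_hullCorners hF hrep.2.1).subset fun x hx => hx.1
  -- The bad corners are closed under passing to hull neighbours, with the same ends `b` and `d`.
  -- The one farthest from `p b` is contradictory, as one of its neighbours is farther still.
  obtain ⟨h, ⟨hh, hhp, hb, hd⟩, hmax⟩ := hTfin.exists_maximalFor (fun x => dist x (p b)) T
    ⟨h₀, hh₀, hp₀, ⟨t, ht, subset_convexHull ℝ _ hz⟩, t', ht', subset_convexHull ℝ _ hz'⟩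
  obtain ⟨k₁, m₁, k₂, m₂, c₁, c₂, c₃⟩ := exists_neighbors_of_mem_hullCorners hF hrep.2.1 hh
  have hk₁ : k₁ ≠ h := by rintro rfl; simp [cross] at c₃
  have hk₂ : k₂ ≠ h := by rintro rfl; rw [cross_self_left] at c₃; exact c₃.false
  have n₁ : k₁ ∈ T := ⟨m₁, opposite_of_hull_neighbor hrep h3 hF hCF hk₁.symm c₁ hh m₁ hk₁
    (cross_self_left _ _) (cross_self_right _ _) hbd hb hd⟩
  have n₂ : k₂ ∈ T := ⟨m₂, opposite_of_hull_neighbor hrep h3 hF hCF hk₂ c₂ hh m₂ hk₂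
    (cross_self_right _ _) (cross_self_left _ _) hbd hb hd⟩
  obtain ⟨t, ht, hz⟩ := hb
  rcases exists_dist_lt_of_cone ht (fun e => hhp ⟨b, e.symm⟩) c₃ (c₁ _ hz) (c₂ _ hz) with hlt | hlt
  · exact hlt.not_ge (hmax n₁ hlt.le)
  · exact hlt.not_ge (hmax n₂ hlt.le)

/-- The face is the component of the complement of the drawing containing the obstacle. A closure
point off the drawing has an open component that meets the face and therefore equals it. -/
theorem exists_isBoundedFace (hD : IsClosed (straightLineDrawing G p))
    (hrep : IsObstacleRepresentation G p C)
    (hC : C ⊆ (unboundedComponent (straightLineDrawing G p))ᶜ) :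
    ∃ F, IsBoundedFace (straightLineDrawing G p) F ∧ C ⊆ F := by
  set D := straightLineDrawing G p with hDdef
  have hCD : C ⊆ Dᶜ := by
    intro x hxC hxD
    rcases hxD with ⟨v, rfl⟩ | ⟨u, v, huv, hx⟩
    · exact hrep.2.2.1 v hxC
    · exact disjoint_left.1 ((hrep.2.2.2 u v).1 huv).2 hx hxC
  obtain ⟨q, hq⟩ := hrep.1.2.1.nonempty
  refine ⟨connectedComponentIn Dᶜ q, ⟨hD.isOpen_compl.connectedComponentIn, ?_,
    ⟨q, mem_connectedComponentIn (hCD hq)⟩,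
    disjoint_left.2 fun x hx => connectedComponentIn_subset _ _ hx, ?_⟩,
    hrep.1.2.1.isPreconnected.subset_connectedComponentIn hq hCD⟩
  · by_contra hb
    exact hC hq ⟨hCD hq, hb⟩
  · rintro x ⟨hx, hx'⟩
    by_contra hxD
    have ho : IsOpen (connectedComponentIn Dᶜ x) := hD.isOpen_compl.connectedComponentIn
    obtain ⟨y, hy, hy'⟩ := mem_closure_iff.1 hx _ ho (mem_connectedComponentIn hxD)
    have e := (connectedComponentIn_eq hy).trans (connectedComponentIn_eq hy').symm
    exact hx' (e ▸ mem_connectedComponentIn hxD)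

/-- In an inside-obstacle representation of a triangle-free graph, the obstacle lies in a convex
polygon whose corners are vertices and whose sides are edges of the graph. -/
theorem exists_convex_cycle_of_inside [Finite V]
    (h3 : ∀ a b c, G.Adj a b → G.Adj b c → ¬ G.Adj a c) (hrep : IsObstacleRepresentation G p C)
    (hC : C ⊆ (unboundedComponent (straightLineDrawing G p))ᶜ) :
    ∃ S : Set V, S.Nonempty ∧ ∀ s ∈ S, ∃ a ∈ S, ∃ b ∈ S, 0 < cross (p s) (p a) (p b) ∧
      (∀ z ∈ C, 0 < cross (p s) (p a) z ∧ 0 < cross (p b) (p s) z) ∧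
      (∀ v ∈ S, 0 ≤ cross (p s) (p a) (p v) ∧ 0 ≤ cross (p b) (p s) (p v)) ∧
      G.Adj s a ∧ G.Adj s b := by
  obtain ⟨F, hF, hCF⟩ := exists_isBoundedFace isClosed_straightLineDrawing hrep hC
  have hsub := hullCorners_subset_range hrep h3 hF hCF
  have hEK : hullCorners F ⊆ convexHull ℝ (closure F) := extremePoints_subset
  refine ⟨p ⁻¹' hullCorners F, ?_, fun s hs => ?_⟩
  · obtain ⟨h, hh⟩ := (isCompact_convexHull_plane hF.isBounded.isCompact_closure).extremePoints_nonempty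
      (hF.nonempty.mono (subset_closure.trans (subset_convexHull ℝ _)))
    obtain ⟨v, rfl⟩ := hsub hh
    exact ⟨v, hh⟩
  · obtain ⟨k₁, m₁, k₂, m₂, c₁, c₂, c₃⟩ := exists_neighbors_of_mem_hullCorners hF hrep.2.1 hs
    obtain ⟨a, rfl⟩ := hsub m₁
    obtain ⟨b, rfl⟩ := hsub m₂
    have hsa : p s ≠ p a := fun h => by simp [h, cross] at c₃
    have hsb : p b ≠ p s := fun h => by rw [h, cross_self_left] at c₃; exact c₃.false
    have p₁ := pos_of_subset_face hF hCF hsa c₁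
    have p₂ := pos_of_subset_face hF hCF hsb c₂
    refine ⟨a, m₁, b, m₂, c₃, fun z hz => ⟨p₁ z hz, p₂ z hz⟩,
      fun v hv => ⟨c₁ _ (hEK hv), c₂ _ (hEK hv)⟩, ?_, ?_⟩
    · exact adj_of_cross_nonpos hrep p₁ (fun h => hsa (by rw [h]))
        (cross_self_left _ _).le (cross_self_right _ _).le
    · exact (adj_of_cross_nonpos hrep p₂ (fun h => hsb (by rw [h]))
        (cross_self_left _ _).le (cross_self_right _ _).le).symm

end InsideFace

/-! ### No inside obstacles for forests and `K_{2,3}` -/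

theorem SimpleGraph.IsAcyclic.not_hasInsideObstacleRepresentation {V : Type*} [Finite V]
    {G : SimpleGraph V} (hG : G.IsAcyclic) : ¬ HasInsideObstacleRepresentation G := by
  classical
  rintro ⟨p, C, hrep, hC⟩
  have h3 : ∀ a b c, G.Adj a b → G.Adj b c → ¬ G.Adj a c := by
    intro a b c hab hbc hac
    obtain ⟨w, hw, h⟩ := hG.exists_neighbors_subsingleton (S := {a, b, c}) (by simp)
    simp only [Finset.mem_insert, Finset.mem_singleton] at hw
    rcases hw with rfl | rfl | rfl
    · exact hbc.ne (h b (by simp) c (by simp) hab hac)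
    · exact hac.ne (h a (by simp) c (by simp) hab.symm hbc)
    · exact hab.ne (h a (by simp) b (by simp) hac.symm hbc.symm)
  obtain ⟨S, hS, h⟩ := exists_convex_cycle_of_inside h3 hrep hC
  obtain ⟨w, hw, hsub⟩ := hG.exists_neighbors_subsingleton (S := S.toFinite.toFinset)
    (by simpa using hS)
  simp only [Finite.mem_toFinset] at hw hsub
  obtain ⟨a, ha, b, hb, hpos, -, -, hwa, hwb⟩ := h w hw
  rw [hsub a ha b hb hwa hwb, cross_self_right] at hpos
  exact hpos.false

/-- A connected set that misses the sides and the segments `x a`, `x c` of a quadrilateral `a b c d`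
with an inner point `x` cannot meet both segments `x b` and `x d`. -/
theorem false_of_quadrilateral {C : Set Plane} (hC : IsPreconnected C) {a b c d x : Plane}
    (h1 : 0 < cross a b x) (h2 : 0 < cross b c x) (h3 : 0 < cross c d x) (h4 : 0 < cross d a x)
    (e1 : Disjoint (segment ℝ a b) C) (e2 : Disjoint (segment ℝ b c) C)
    (e3 : Disjoint (segment ℝ c x) C) (e4 : Disjoint (segment ℝ x a) C)
    (n1 : ¬ Disjoint (segment ℝ x b) C) (n2 : ¬ Disjoint (segment ℝ x d) C) : False := by
  obtain ⟨z, hz, hzC⟩ := not_disjoint_iff.1 n1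
  obtain ⟨y, hy, hyC⟩ := not_disjoint_iff.1 n2
  -- `C` meets the segment `x b`, so it is trapped in the part of the quadrilateral that the path `a
  -- x c` cuts off on the side of `b`; the rest of `x d` is outside that part.
  have hsub : C ⊆ closedTriangle a b x ∪ closedTriangle b c x := by
    refine hC.subset_of_frontier ?_ ⟨z, hzC, Or.inl ⟨?_, ?_, ?_⟩⟩
    · refine (Disjoint.mono_left (frontier_union_closedTriangle h1 h2) ?_).symm
      simp only [disjoint_union_left]
      exact ⟨⟨⟨e1, e2⟩, e3⟩, e4⟩
    · exact segment_subset_cross_nonneg h1.le (cross_self_right _ _).ge hz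
    · exact segment_subset_cross_nonneg (cross_self_right _ _).ge (cross_self_left _ _).ge hz
    · exact segment_subset_cross_nonneg (cross_self_left _ _).ge (by rw [← cross_rotate]; exact h1.le) hz
  have hxC : x ∉ C := disjoint_left.1 e4 (left_mem_segment ℝ _ _)
  obtain ⟨s, t, hs, ht, hst, rfl⟩ := hy
  have ht : 0 < t := ht.lt_of_ne' fun h => hxC (by simpa [h, show s = 1 by linarith] using hyC)
  rcases hsub hyC with ⟨-, -, h⟩ | ⟨-, h, -⟩
  · rw [cross_combo _ _ _ _ hst, cross_self_left, ← cross_rotate x a d, cross_swap d a x] at h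
    nlinarith
  · rw [cross_combo _ _ _ _ hst, cross_self_right, cross_swap' c d x] at h
    nlinarith

/-- The convex cycle is `i k j l` with `k`, `l` from the side of size three. The remaining vertex
`m` is inside, its edges to `i` and `j` split the quadrilateral, and the obstacle must block both `m
k` and `m l`. -/
theorem completeBipartiteGraph_two_three_not_hasInsideObstacleRepresentation :
    ¬ HasInsideObstacleRepresentation (completeBipartiteGraph (Fin 2) (Fin 3)) := by
  rintro ⟨p, C, hrep, hC⟩
  obtain ⟨S, ⟨s, hs⟩, H⟩ := exists_convex_cycle_of_inside (by
    rintro (a | a) (b | b) (c | c) <;> simp) hrep hC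
  obtain ⟨i, hi⟩ : ∃ i, Sum.inl i ∈ S := by
    rcases s with i | w
    · exact ⟨i, hs⟩
    · obtain ⟨a | a, ha, -, -, -, -, -, h, -⟩ := H _ hs
      · exact ⟨a, ha⟩
      · simp at h
  obtain ⟨a, ha, b, hb, hpos, hCi, hSi, hia, hib⟩ := H _ hi
  obtain ⟨k, rfl⟩ : ∃ k, a = Sum.inr k := by rcases a with a | a <;> simp at hia ⊢
  obtain ⟨l, rfl⟩ : ∃ l, b = Sum.inr l := by rcases b with b | b <;> simp at hib ⊢
  have hkl : k ≠ l := by rintro rfl; rw [cross_self_right] at hpos; exact hpos.false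
  -- the successor of `k` and the predecessor of `l` are both the other vertex on the small side
  obtain ⟨j, hji, hCk⟩ : ∃ j, j ≠ i ∧ ∀ z ∈ C, 0 < cross (p (.inr k)) (p (.inl j)) z := by
    obtain ⟨c, _, _, _, _, hC', hS', hkc, _⟩ := H _ ha
    obtain ⟨j, rfl⟩ : ∃ j, c = Sum.inl j := by rcases c with c | c <;> simp at hkc ⊢
    refine ⟨j, ?_, fun z hz => (hC' z hz).1⟩
    rintro rfl
    have := (hS' _ hb).1
    rw [cross_swap] at this
    linarith
  obtain ⟨j', hji', hCl⟩ : ∃ j, j ≠ i ∧ ∀ z ∈ C, 0 < cross (p (.inl j)) (p (.inr l)) z := by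
    obtain ⟨_, _, c, _, _, hC', hS', _, hlc⟩ := H _ hb
    obtain ⟨j, rfl⟩ : ∃ j, c = Sum.inl j := by rcases c with c | c <;> simp at hlc ⊢
    refine ⟨j, ?_, fun z hz => (hC' z hz).2⟩
    rintro rfl
    have := (hS' _ ha).2
    rw [cross_swap'] at this
    linarith
  obtain rfl : j' = j := by omega
  obtain ⟨m, hmk, hml⟩ : ∃ m : Fin 3, m ≠ k ∧ m ≠ l := by
    have : ∀ k l : Fin 3, ∃ m, m ≠ k ∧ m ≠ l := by decide
    exact this k l
  have hedge (u : Fin 2) (w : Fin 3) : Disjoint (segment ℝ (p (.inl u)) (p (.inr w))) C :=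
    ((hrep.2.2.2 _ _).1 (by simp)).2
  have hno {w w' : Fin 3} (h : w ≠ w') : ¬ Disjoint (segment ℝ (p (.inr w)) (p (.inr w'))) C :=
    fun hd => by simpa using (hrep.2.2.2 (.inr w) (.inr w')).2 ⟨by simpa using h, hd⟩
  -- If `m` were not strictly inside this side, its segment to a corner on the side would miss the
  -- obstacle, although the two vertices are not adjacent.
  have hin {x y : Plane} (hxy : ∀ z ∈ C, 0 < cross x y z) {w : Fin 3} (hw : m ≠ w)
      (h0 : cross x y (p (.inr w)) = 0) : 0 < cross x y (p (.inr m)) := by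
    by_contra! hle
    exact hno hw (disjoint_segment_of_cross_nonpos hxy hle h0.le)
  refine false_of_quadrilateral hrep.1.2.1.isPreconnected
    (hin (fun z hz => (hCi z hz).1) hmk (cross_self_right _ _)) (hin hCk hmk (cross_self_left _ _))
    (hin hCl hml (cross_self_right _ _))
    (hin (fun z hz => (hCi z hz).2) hml (cross_self_left _ _))
    (hedge _ _) (by rw [segment_symm]; exact hedge _ _) (hedge _ _)
    (by rw [segment_symm]; exact hedge _ _) (hno hmk) (hno hml)

/-! ### Relabelling of vertices and conclusion -/

section Comap

variable {V W : Type*} {G : SimpleGraph V}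

theorem straightLineDrawing_comap (e : W ≃ V) (p : V → Plane) :
    straightLineDrawing (G.comap e) (p ∘ e) = straightLineDrawing G p := by
  simp [straightLineDrawing, e.surjective.range_comp, e.surjective.exists]

theorem IsObstacleRepresentation.comap {p : V → Plane} {C : Set Plane}
    (h : IsObstacleRepresentation G p C) (e : W ≃ V) :
    IsObstacleRepresentation (G.comap e) (p ∘ e) C := by
  obtain ⟨hC, hp, hpC, hadj⟩ := h
  refine ⟨hC, ⟨hp.1.comp e.injective, fun u v w huv huw hvw => ?_⟩, fun v => hpC _,
    fun u v => ?_⟩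
  · exact hp.2 _ _ _ (e.injective.ne huv) (e.injective.ne huw) (e.injective.ne hvw)
  · rw [SimpleGraph.comap_adj, hadj, e.injective.ne_iff]; rfl

theorem HasInsideObstacleRepresentation.comap (h : HasInsideObstacleRepresentation G)
    (e : W ≃ V) : HasInsideObstacleRepresentation (G.comap e) := by
  obtain ⟨p, C, hrep, hC⟩ := h
  exact ⟨p ∘ e, C, hrep.comap e, by rwa [straightLineDrawing_comap]⟩

theorem HasOutsideObstacleRepresentation.comap (h : HasOutsideObstacleRepresentation G)
    (e : W ≃ V) : HasOutsideObstacleRepresentation (G.comap e) := by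
  obtain ⟨p, C, hrep, hC⟩ := h
  exact ⟨p ∘ e, C, hrep.comap e, by rwa [straightLineDrawing_comap]⟩

end Comap

theorem not_insideObstacleClass_subset : ¬ insideObstacleClass ⊆ outsideObstacleClass := by
  intro h
  have hcard : Fintype.card B11Vertex = 11 := by rw [Fintype.card_congr B11Vertex.equivSum]; rfl
  let e : Fin 11 ≃ B11Vertex := (Fintype.equivFinOfCardEq hcard).symm
  have hout : HasOutsideObstacleRepresentation (B11.comap e) :=
    h (a := ⟨11, B11.comap e⟩) (B11_hasInsideObstacleRepresentation.comap e)
  refine B11_not_hasOutsideObstacleRepresentation ?_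
  have := hout.comap e.symm
  rwa [show (B11.comap e).comap e.symm = B11 by ext; simp] at this

theorem not_outsideObstacleClass_subset : ¬ outsideObstacleClass ⊆ insideObstacleClass := fun h =>
  SimpleGraph.isAcyclic_bot.not_hasInsideObstacleRepresentation
    (h (a := ⟨2, ⊥⟩) SimpleGraph.isAcyclic_bot.hasOutsideObstacleRepresentation)

theorem mainTheorem5 :
    -- the two classes are incomparable with respect to inclusion
    (¬ insideObstacleClass ⊆ outsideObstacleClass ∧
      ¬ outsideObstacleClass ⊆ insideObstacleClass) ∧
    -- `B₁₁` is in the first class but not in the second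
    (HasInsideObstacleRepresentation B11 ∧ ¬ HasOutsideObstacleRepresentation B11) ∧
    -- acyclic non-complete graphs are in the second class but not in the first
    (∀ (V : Type*) [Finite V] (G : SimpleGraph V), G.IsAcyclic → G ≠ ⊤ →
      HasOutsideObstacleRepresentation G ∧ ¬ HasInsideObstacleRepresentation G) ∧
    -- and so is `K_{2,3}`
    (HasOutsideObstacleRepresentation (completeBipartiteGraph (Fin 2) (Fin 3)) ∧
      ¬ HasInsideObstacleRepresentation (completeBipartiteGraph (Fin 2) (Fin 3))) := by
  refine ⟨⟨not_insideObstacleClass_subset, not_outsideObstacleClass_subset⟩,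
    ⟨B11_hasInsideObstacleRepresentation, B11_not_hasOutsideObstacleRepresentation⟩,
    fun V _ G hG hne => ⟨?_, hG.not_hasInsideObstacleRepresentation⟩,
    completeBipartiteGraph_two_three_hasOutsideObstacleRepresentation,
    completeBipartiteGraph_two_three_not_hasInsideObstacleRepresentation⟩
  -- On an empty vertex set the only graph is complete, so non-completeness provides a vertex.
  have : Nonempty V := by
    by_contra hV
    rw [not_nonempty_iff] at hV
    exact hne (Subsingleton.elim _ _)
  exact hG.hasOutsideObstacleRepresentation
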